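/- Let $\triangle=[v_1,v_2,v_3]\subset\mathbb R^2$ be a nondegenerate closed triangle, and put $v_4=\frac{v_1+v_2}2$, $v_5=\frac{v_2+v_3}2$, $v_6=\frac{v_1+v_3}2$, $v_7=\frac{v_4+v_6}2$, $v_8=\frac{v_4+v_5}2$, $v_9=\frac{v_5+v_6}2$, $v_{10}=\frac{v_1+v_2+v_3}3$. The lines joining the vertices and edge midpoints of $\triangle$ divide it into 12 triangular faces (the Powell–Sabin 12-split, with vertices $v_1,\dots,v_{10}$). Let $\mathcal S^3_5$ be the space of $C^3$ functions on $\triangle$ whose restriction to each face is a polynomial of total degree at most $5$. Fix a rule assigning each point of $\triangle$ to one face containing it. For a finite multiset $K$ of points $v_j$, let $[K]$ be its convex hull and $[K)$ the set of points of $\triangle$ assigned to faces contained in $[K]$. The simplex spline $Q[K]$ is defined recursively by $Q[K]=0$ if $\mathrm{area}[K]=0$; $Q[K]=\mathbf 1_{[K)}\,\mathrm{area}(\triangle)/\mathrm{area}[K]$ if $|K|=3$ and $\mathrm{area}[K]\ne0$; and otherwise $Q[K](x)=\sum_j\beta_jQ[K\setminus v_j](x)$, where $x=\sum_j\beta_jv_j$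 is an affine combination of knots of $K$ (for definiteness, the barycentric representation with respect to the first noncollinear triple of knots). Write $Q_{ijklmn}=Q[v_1^iv_2^jv_3^kv_4^lv_5^mv_6^n]$. Consider the following scaled simplex splines $S=wQ[K]$, each given together with a family of five dual points (exponents are multiplicities): - $a$: $\frac14Q_{600101}$, $v_1^5$; - $b$: $\frac14Q_{500201}$, $v_1^4v_4$; - $e$: $\frac12Q_{410201}$, $v_1^3v_4^2$; - $f$: $\frac12Q_{320201}$, $v_1^2v_2v_4^2$; - $g$: $\frac34Q_{220211}$, $v_1v_2v_4^2v_{10}$; - $g'$: $\frac14Q_{220211}$, $v_1v_2v_3v_4^2$; - $l$: $Q_{141110}$, $v_2^3v_4v_5$; - $n$: $\frac34Q_{222110}$, $v_1v_2^2v_3v_{10}$; - $o$: $\frac34Q_{221111}$, $v_1v_2v_3v_4v_{10}$; - $q$: $Q_{321200}$, $v_1^2v_2v_4^2$; - $r$: $\frac12Q_{131210}$, $v_1v_2^2v_4v_5$; - $s$: $\frac34Q_{221210}$, $v_1v_2^2v_4v_{10}$; - $s'$: $\frac14Q_{221210}$, $v_1v_2^2v_3v_4$; - $t$: $\frac34Q_{121211}$,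 $v_1v_2v_4v_5v_{10}$; - $t'$: $\frac12Q_{121211}$, $v_1v_2v_3v_4v_8$. The six bases $\mathcal B_a,\dots,\mathcal B_f$ consist of all images, under the permutations of $v_1,\dots,v_{10}$ induced by permuting the corners $v_1,v_2,v_3$, of $\{a,b,e,f,l,n,r,s\}$, $\{a,b,e,f,l,o,r,s\}$, $\{a,b,e,f,g,l,r,t\}$, $\{a,b,e,l,n,q,r,s'\}$, $\{a,b,e,l,o,q,r,s'\}$, $\{a,b,e,g',l,q,r,t'\}$, respectively; each has 39 elements $S_1,\dots,S_{39}$. Let $p^*_{i,1},\dots,p^*_{i,5}$ be the dual points of $S_i$, and for $f\in C^0(\triangle)$ put $$Q(f)=\sum_{i=1}^{39}L_i(f)S_i,\qquad L_i(f)=\sum_{k=1}^5\frac{k^5}{5!}(-1)^{k-1}\sum_{1\le r_1<\dots<r_k\le5}f\Big(\frac{p^*_{i,r_1}+\dots+p^*_{i,r_k}}k\Big).$$ Then, for each of the six bases and every nondegenerate triangle $\triangle$: 1. $Q$ maps $C^0(\triangle)$ into $\mathcal S^3_5$; 2. $Q(p)=p$ on $\triangle$ for every polynomial $p$ of total degree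 at most $5$; 3. $\|Q(f)\|_{L_\infty(\triangle)}\le\frac{275}3\|f\|_{L_\infty(\triangle)}$ for every $f\in C^0(\triangle)$; 4. $Q$ has local approximation order $6$: there is an absolute constant $C$, independent of the triangle, of the basis and of $f$, such that for every $f\in C^0(\triangle)$ whose weak derivatives of order at most $6$ in the interior of $\triangle$ lie in $L_\infty$, $$\|Q(f)-f\|_{L_\infty(\triangle)}\le C\,h^6\max_{|\alpha|=6}\|D^\alpha f\|_{L_\infty(\triangle)},\qquad h=\operatorname{diam}\triangle .$$ -/

import Mathlib

open MeasureTheory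
open scoped ContDiff ENNReal

namespace PS12

/-- The Euclidean plane. -/
abbrev Plane : Type := EuclideanSpace ℝ (Fin 2)

/-! ### The Powell-Sabin 12-split.  Vertices `v₁, …, v₁₀` are indexed by `0, …, 9`. -/

/-- The closed triangle with vertices `v 0, v 1, v 2`. -/
def triangle (v : Fin 3 → Plane) : Set Plane := convexHull ℝ (Set.range v)

/-- The ten vertices of the 12-split: the three corners, the midpoints of the edges
`[v₁, v₂]`, `[v₂, v₃]`, `[v₁, v₃]`, then `(v₄ + v₆)/2`, `(v₄ + v₅)/2`, `(v₅ + v₆)/2`, and the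
barycentre. -/
noncomputable def vertex (v : Fin 3 → Plane) : Fin 10 → Plane :=
  let v₄ := (1 / 2 : ℝ) • (v 0 + v 1)
  let v₅ := (1 / 2 : ℝ) • (v 1 + v 2)
  let v₆ := (1 / 2 : ℝ) • (v 0 + v 2)
  ![v 0, v 1, v 2, v₄, v₅, v₆,
    (1 / 2 : ℝ) • (v₄ + v₆), (1 / 2 : ℝ) • (v₄ + v₅), (1 / 2 : ℝ) • (v₅ + v₆),
    (1 / 3 : ℝ) • (v 0 + v 1 + v 2)]

/-- The vertices of the twelve faces of the 12-split (the numbering of the faces is immaterial). -/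
def faceVertices : Fin 12 → Fin 3 → Fin 10 :=
  ![![0, 3, 6], ![0, 5, 6], ![1, 3, 7], ![1, 4, 7], ![2, 4, 8], ![2, 5, 8],
    ![9, 3, 6], ![9, 3, 7], ![9, 4, 7], ![9, 4, 8], ![9, 5, 8], ![9, 5, 6]]

/-- The closed faces of the 12-split. -/
noncomputable def face (v : Fin 3 → Plane) (k : Fin 12) : Set Plane :=
  triangle fun i => vertex v (faceVertices k i)

/-- A scheme assigning every point of the macrotriangle to a unique face containing it. -/
def IsFaceScheme (v : Fin 3 → Plane) (ρ : Plane → Fin 12) : Prop :=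
  ∀ x ∈ triangle v, x ∈ face v (ρ x)

/-- The half-open faces determined by the scheme `ρ`. -/
def halfOpenFace (v : Fin 3 → Plane) (ρ : Plane → Fin 12) (k : Fin 12) : Set Plane :=
  {x | x ∈ face v k ∧ ρ x = k}

/-- The space `S^r_d` of `C^r` splines of degree at most `d` on the 12-split.  Only the values on
the closed macrotriangle matter. -/
def splineSpace (v : Fin 3 → Plane) (r d : ℕ) : Set (Plane → ℝ) :=
  {s | ContDiffOn ℝ r s (triangle v) ∧
    ∀ k : Fin 12, ∃ p : MvPolynomial (Fin 2) ℝ, p.totalDegree ≤ d ∧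
      ∀ x ∈ face v k, s x = MvPolynomial.eval (fun i => x i) p}

/-! ### Simplex splines.  A knot multiset is a `Multiset (Fin 10)` of indices of vertices. -/

/-- The convex hull `[K]` of a knot multiset. -/
noncomputable def hull (v : Fin 3 → Plane) (K : Multiset (Fin 10)) : Set Plane :=
  convexHull ℝ (vertex v '' {j | j ∈ K})

/-- The half-open convex hull `[K)`: the union of the half-open faces of the faces in `[K]`. -/
noncomputable def halfOpenHull (v : Fin 3 → Plane) (ρ : Plane → Fin 12)
    (K : Multiset (Fin 10)) : Set Plane :=
  ⋃ k ∈ {k : Fin 12 | face v k ⊆ hull v K}, halfOpenFace v ρ k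

/-- Area of a subset of the plane. -/
noncomputable def area (A : Set Plane) : ℝ := (volume A).toReal

/-- Twice the signed area of the triangle with vertices `a, b, c`. -/
def orient (a b c : Plane) : ℝ :=
  (b 0 - a 0) * (c 1 - a 1) - (b 1 - a 1) * (c 0 - a 0)

/-- All triples `(i, j, k)` with `i < j < k`, in lexicographic order. -/
def triples : List (Fin 10 × Fin 10 × Fin 10) :=
  (List.finRange 10 ×ˢ (List.finRange 10 ×ˢ List.finRange 10)).filter
    fun t => t.1 < t.2.1 ∧ t.2.1 < t.2.2

open Classical in
/-- The first triple of knots in `K` that are not collinear, if there is one. -/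
noncomputable def knotTriple (v : Fin 3 → Plane) (K : Multiset (Fin 10)) :
    Option (Fin 10 × Fin 10 × Fin 10) :=
  triples.find? fun t => t.1 ∈ K ∧ t.2.1 ∈ K ∧ t.2.2 ∈ K ∧
    orient (vertex v t.1) (vertex v t.2.1) (vertex v t.2.2) ≠ 0

open Classical in
/-- The recursion for the simplex spline with `d + 3` knots.  In each step `x` is written as an
affine combination `∑ βⱼ vⱼ` of knots of `K`; since the outcome does not depend on which affine
combination is taken, we take the barycentric coordinates of `x` with respect to the first
noncollinear triple of knots (all other `βⱼ` being zero). -/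
noncomputable def simplexSplineAux (v : Fin 3 → Plane) (ρ : Plane → Fin 12) :
    ℕ → Multiset (Fin 10) → Plane → ℝ
  | 0, K, x =>
      if area (hull v K) = 0 then 0
      else (halfOpenHull v ρ K).indicator (fun _ => area (triangle v) / area (hull v K)) x
  | d + 1, K, x =>
      if area (hull v K) = 0 then 0
      else match knotTriple v K with
        | none => 0
        | some (i, j, k) =>
            let a := vertex v i
            let b := vertex v j
            let c := vertex v k
            orient x b c / orient a b c * simplexSplineAux v ρ d (K.erase i) x +
            orient a x c / orient a b c * simplexSplineAux v ρ d (K.erase j) x +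
            orient a b x / orient a b c * simplexSplineAux v ρ d (K.erase k) x

/-- The area normalized simplex spline `Q[K]`, of degree `|K| - 3`. -/
noncomputable def simplexSpline (v : Fin 3 → Plane) (ρ : Plane → Fin 12)
    (K : Multiset (Fin 10)) : Plane → ℝ :=
  simplexSplineAux v ρ (K.card - 3) K

/-! ### The six bases -/

/-- A scaled simplex spline `w • Q[K]`, together with its multiset of dual points. -/
structure BasisElement where
  weight : ℚ
  knots : Multiset (Fin 10)
  dual : Multiset (Fin 10)

instance : DecidableEq BasisElement := fun a b =>
  decidable_of_iff (a.weight = b.weight ∧ a.knots = b.knots ∧ a.dual = b.dual)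
    (by cases a; cases b; simp)

/-- The knot multiset `v₁^i v₂^j v₃^k v₄^l v₅^m v₆^n`. -/
def kn (i j k l m n : ℕ) : Multiset (Fin 10) :=
  Multiset.replicate i 0 + Multiset.replicate j 1 + Multiset.replicate k 2 +
    Multiset.replicate l 3 + Multiset.replicate m 4 + Multiset.replicate n 5

/-- The permutation of the ten vertices induced by a permutation of the three corners. -/
def symVertex (σ : Equiv.Perm (Fin 3)) : Fin 10 → Fin 10 :=
  let corner : Fin 3 → Fin 10 := ![0, 1, 2]
  -- midpoint of the edge opposite to a corner
  let opposite : Fin 3 → Fin 10 := ![4, 5, 3]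
  -- midpoint of the two edge midpoints next to a corner
  let inner : Fin 3 → Fin 10 := ![6, 7, 8]
  ![corner (σ 0), corner (σ 1), corner (σ 2), opposite (σ 2), opposite (σ 0), opposite (σ 1),
    inner (σ 0), inner (σ 1), inner (σ 2), 9]

def BasisElement.sym (σ : Equiv.Perm (Fin 3)) (b : BasisElement) : BasisElement :=
  ⟨b.weight, b.knots.map (symVertex σ), b.dual.map (symVertex σ)⟩

/-- Representatives, one for each symmetry class, of the six bases `B_a, …, B_f`.  The third entry
lists the dual points: the linear factor `c_j` of the dual polynomial has index `j - 1`. -/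
def representatives : Fin 6 → List BasisElement :=
  let qa : BasisElement := ⟨1/4, kn 6 0 0 1 0 1, {0, 0, 0, 0, 0}⟩
  let qb : BasisElement := ⟨1/4, kn 5 0 0 2 0 1, {0, 0, 0, 0, 3}⟩
  let qe : BasisElement := ⟨1/2, kn 4 1 0 2 0 1, {0, 0, 0, 3, 3}⟩
  let qf : BasisElement := ⟨1/2, kn 3 2 0 2 0 1, {0, 0, 1, 3, 3}⟩
  let qg : BasisElement := ⟨3/4, kn 2 2 0 2 1 1, {0, 1, 3, 3, 9}⟩
  let qg' : BasisElement := ⟨1/4, kn 2 2 0 2 1 1, {0, 1, 2, 3, 3}⟩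
  let ql : BasisElement := ⟨1, kn 1 4 1 1 1 0, {1, 1, 1, 3, 4}⟩
  let qn : BasisElement := ⟨3/4, kn 2 2 2 1 1 0, {0, 1, 1, 2, 9}⟩
  let qo : BasisElement := ⟨3/4, kn 2 2 1 1 1 1, {0, 1, 2, 3, 9}⟩
  let qq : BasisElement := ⟨1, kn 3 2 1 2 0 0, {0, 0, 1, 3, 3}⟩
  let qr : BasisElement := ⟨1/2, kn 1 3 1 2 1 0, {0, 1, 1, 3, 4}⟩
  let qs : BasisElement := ⟨3/4, kn 2 2 1 2 1 0, {0, 1, 1, 3, 9}⟩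
  let qs' : BasisElement := ⟨1/4, kn 2 2 1 2 1 0, {0, 1, 1, 2, 3}⟩
  let qt : BasisElement := ⟨3/4, kn 1 2 1 2 1 1, {0, 1, 3, 4, 9}⟩
  let qt' : BasisElement := ⟨1/2, kn 1 2 1 2 1 1, {0, 1, 2, 3, 7}⟩
  ![[qa, qb, qe, qf, ql, qn, qr, qs],
    [qa, qb, qe, qf, ql, qo, qr, qs],
    [qa, qb, qe, qf, qg, ql, qr, qt],
    [qa, qb, qe, ql, qn, qq, qr, qs'],
    [qa, qb, qe, ql, qo, qq, qr, qs'],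
    [qa, qb, qe, qg', ql, qq, qr, qt']]

/-- The six bases: the symmetry classes of the representatives. -/
def basis (n : Fin 6) : Finset BasisElement :=
  (representatives n).toFinset.biUnion fun b => Finset.univ.image fun σ => b.sym σ

/-! ### The quasi-interpolant -/

/-- `L(f) = ∑_{k=1}^5 (k^5/5!) (-1)^(k-1) ∑ f((p_{r₁} + ⋯ + p_{r_k})/k)`, the inner sum being over
the `k`-element subfamilies of the family `P` of dual points. -/
noncomputable def coeffFunctional (P : Multiset Plane) (f : Plane → ℝ) : ℝ :=
  ∑ k ∈ Finset.Icc (1 : ℕ) 5, ((k : ℝ) ^ 5 / (Nat.factorial 5 : ℝ)) * (-1) ^ (k - 1) *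
    ((P.powersetCard k).map fun R => f ((k : ℝ)⁻¹ • R.sum)).sum

/-- The operator `Q(f) = ∑ L_i(f) S_i`, with `S_i = w_i Q[K_i]`, for the basis number `n`. -/
noncomputable def quasiInterpolant (v : Fin 3 → Plane) (ρ : Plane → Fin 12) (n : Fin 6)
    (f : Plane → ℝ) (x : Plane) : ℝ :=
  ∑ b ∈ basis n, coeffFunctional (b.dual.map (vertex v)) f *
    ((b.weight : ℝ) * simplexSpline v ρ b.knots x)

/-! ### Norms and Sobolev regularity -/

/-- The maximum norm on `A`, for functions continuous on a compact set `A`. -/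
noncomputable def supNorm (A : Set Plane) (f : Plane → ℝ) : ℝ :=
  sSup ((fun x => |f x|) '' A)

/-- The partial derivative in the `i`-th coordinate direction. -/
noncomputable def partialDeriv (i : Fin 2) (φ : Plane → ℝ) (x : Plane) : ℝ :=
  fderiv ℝ φ x (EuclideanSpace.single i 1)

/-- `g` is the weak partial derivative of `f` of multi-index `α` on the open set `U`. -/
def IsWeakDeriv (U : Set Plane) (α : ℕ × ℕ) (f g : Plane → ℝ) : Prop :=
  ∀ φ : Plane → ℝ, ContDiff ℝ ∞ φ → HasCompactSupport φ → tsupport φ ⊆ U →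
    ∫ x in U, f x * ((partialDeriv 0)^[α.1] ((partialDeriv 1)^[α.2] φ)) x =
      (-1) ^ (α.1 + α.2) * ∫ x in U, g x * φ x

/-- `f` lies in the Sobolev space `W^{m,∞}(U)`, with weak partial derivatives `g α`, `|α| ≤ m`. -/
def IsSobolevWith (U : Set Plane) (m : ℕ) (f : Plane → ℝ) (g : ℕ × ℕ → Plane → ℝ) : Prop :=
  ∀ α : ℕ × ℕ, α.1 + α.2 ≤ m → MemLp (g α) ∞ (volume.restrict U) ∧ IsWeakDeriv U α f (g α)

/-- `max_{|α| = m} ‖g α‖_{L∞(U)}`. -/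
noncomputable def sobolevSeminorm (U : Set Plane) (m : ℕ) (g : ℕ × ℕ → Plane → ℝ) : ℝ :=
  ((Finset.HasAntidiagonal.antidiagonal m).sup fun α => eLpNorm (g α) ∞ (volume.restrict U)).toReal

end PS12

open PS12

/-! In barycentric coordinates nothing depends on the triangle. The vertices of the split have fixed
rational coordinates, the relative areas of the triangles met in the recursion are fixed, and the
recursion multiplies by affine functions with integer coefficients. On each face a simplex spline is
therefore one explicit integer polynomial in two barycentric coordinates (`simplexSplineAux_eq`),
and the facts peculiar to the six bases become finitely many integer checks (`checks_eq_true`).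

There are three such facts. Each spline equals `p + ∑ qᵢ max (ℓᵢ, 0) ^ 4` on the triangle, with `qᵢ`
affine and `ℓᵢ` vanishing on the lines of the split (`eval_piece_of_mem_face`); this gives C³
smoothness and makes the values independent of the face scheme. Each spline is nonnegative, since on
every face it is a form with nonnegative coefficients in the barycentric coordinates of that face
(`eval_piece_nonneg`). And a Marsden identity holds: for affine `c`, the sum of `Sᵢ(x) ∏ⱼ c(p*ᵢⱼ)`
is `c(x) ^ 5` (`marsden`).

The functional `Lᵢ` is the polarization of the fifth power, so `Lᵢ(c ^ 5) = ∏ⱼ c(p*ᵢⱼ)`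
(`coeffFunctional_affine_pow`). With the Marsden identity, `Q` reproduces fifth powers of affine
functions, and these span the quintics (`map_eq_zero_of_affine_pow`). With `c = 1` the splines sum
to one, so `Q(f)(x)` is a convex combination of the `Lᵢ(f)`, each at most `275/3` times the norm of
`f` (`abs_quasiInterpolantAt_le`).

For the order of approximation, `Q(f) - f = Q(f - P) - (f - P)` for every quintic `P`, so a quintic
within `O(h ^ 6)` of `f` is enough. As `f` has only weak derivatives, `P` comes from the Taylor
polynomial of a mollification of `f`. The triangle is first contracted towards an interior point so
that the mollifier stays inside, and the errors of contraction and mollification are arbitrarily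
small (`exists_polynomial_near`). -/

namespace PS12

/-! ### Computable multivariate polynomials -/

/-- Coefficient rings of computable polynomials.  An iterated list `List (⋯ (List ℤ))` is a
polynomial with integer coefficients, the outermost list being sorted by the powers of the first
variable; `eval` takes the list of the values of the variables. -/
class Coeff (α : Type) where
  zero : α
  add : α → α → α
  mul : α → α → α
  scale : ℤ → α → α
  isZero : α → Bool
  nonneg : α → Bool
  eval : α → List ℝ → ℝ
  eval_zero : ∀ e, eval zero e = 0
  eval_add : ∀ p q e, eval (add p q) e = eval p e + eval q e
  eval_mul : ∀ p q e, eval (mul p q) e = eval p e * eval q e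
  eval_scale : ∀ z p e, eval (scale z p) e = z * eval p e
  eval_of_isZero : ∀ p e, isZero p = true → eval p e = 0
  eval_nonneg : ∀ p e, (∀ x ∈ e, (0 : ℝ) ≤ x) → nonneg p = true → 0 ≤ eval p e

instance : Coeff ℤ where
  zero := 0
  add := Int.add
  mul := Int.mul
  scale := Int.mul
  isZero z := match z with
    | Int.ofNat n => Nat.beq n 0
    | _ => false
  nonneg z := match z with
    | Int.ofNat _ => true
    | _ => false
  eval z _ := z
  eval_zero _ := Int.cast_zero
  eval_add p q _ := Int.cast_add p q
  eval_mul p q _ := Int.cast_mul p q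
  eval_scale p q _ := Int.cast_mul p q
  eval_of_isZero p e h := by
    rcases p with n | n
    · have : n = 0 := Nat.eq_of_beq_eq_true h
      simp [this]
    · simp at h
  eval_nonneg p e _ h := by
    rcases p with n | n
    · simp
    · simp at h

section Lists

variable {α : Type}

def addList (f : α → α → α) : List α → List α → List α
  | [], q => q
  | a :: p, [] => a :: p
  | a :: p, b :: q => f a b :: addList f p q

/-- The two matches save work: zero coefficients are not multiplied out, and an empty product stays
empty instead of being padded by a zero. -/
def mulList (isz : α → Bool) (z : α) (f g : α → α → α) : List α → List α → List α
  | [], _ => []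
  | a :: p, q => addList f
      (match isz a with
        | true => []
        | false => q.map (g a))
      (match mulList isz z f g p q with
        | [] => []
        | b :: r => z :: b :: r)

def scaleList (f : ℤ → α → α) : ℤ → List α → List α
  | Int.ofNat 0, _ => []
  | z, p => p.map (f z)

variable [Coeff α]

def evalList : List α → List ℝ → ℝ
  | [], _ => 0
  | a :: p, e => Coeff.eval a e.tail + e.headD 0 * evalList p e

theorem evalList_add (p q : List α) (e : List ℝ) :
    evalList (addList Coeff.add p q) e = evalList p e + evalList q e := by
  induction p generalizing q with
  | nil => simp [addList, evalList]
  | cons a p ih =>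
    cases q with
    | nil => simp [addList, evalList]
    | cons b q => simp only [addList, evalList, Coeff.eval_add, ih]; ring

theorem evalList_map (f : α → α) (c : ℝ) (e : List ℝ)
    (hf : ∀ a, Coeff.eval (f a) e.tail = c * Coeff.eval a e.tail) (p : List α) :
    evalList (p.map f) e = c * evalList p e := by
  induction p with
  | nil => simp [evalList]
  | cons a p ih => simp only [List.map_cons, evalList, hf, ih]; ring

theorem evalList_mul (p q : List α) (e : List ℝ) :
    evalList (mulList Coeff.isZero Coeff.zero Coeff.add Coeff.mul p q) e =
      evalList p e * evalList q e := by
  induction p with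
  | nil => simp [mulList, evalList]
  | cons a p ih =>
    rw [mulList, evalList_add]
    have h1 : evalList (match Coeff.isZero a with
        | true => []
        | false => q.map (Coeff.mul a)) e = Coeff.eval a e.tail * evalList q e := by
      cases h : Coeff.isZero a with
      | true => simp [evalList, Coeff.eval_of_isZero a _ h]
      | false => exact evalList_map _ _ _ (fun b => Coeff.eval_mul _ _ _) _
    have h2 : evalList (match mulList Coeff.isZero Coeff.zero Coeff.add Coeff.mul p q with
        | [] => []
        | b :: r => (Coeff.zero : α) :: b :: r) e = e.headD 0 * (evalList p e * evalList q e) := by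
      rw [← ih]
      cases mulList Coeff.isZero Coeff.zero Coeff.add Coeff.mul p q with
      | nil => simp [evalList]
      | cons b r => simp [evalList, Coeff.eval_zero]
    rw [h1, h2, evalList]
    ring

theorem evalList_scale (z : ℤ) (p : List α) (e : List ℝ) :
    evalList (scaleList Coeff.scale z p) e = z * evalList p e := by
  unfold scaleList
  split
  · simp [evalList]
  · exact evalList_map _ _ _ (fun b => Coeff.eval_scale _ _ _) _

theorem evalList_of_all_isZero (p : List α) (e : List ℝ) (h : p.all Coeff.isZero = true) :
    evalList p e = 0 := by
  induction p with
  | nil => rfl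
  | cons a p ih =>
    rw [List.all_cons, Bool.and_eq_true] at h
    simp [evalList, ih h.2, Coeff.eval_of_isZero a _ h.1]

theorem evalList_nonneg (p : List α) (e : List ℝ) (he : ∀ x ∈ e, (0 : ℝ) ≤ x)
    (h : p.all Coeff.nonneg = true) : 0 ≤ evalList p e := by
  have he0 : 0 ≤ e.headD 0 := by
    cases e with
    | nil => simp
    | cons a l => exact he a (by simp)
  induction p with
  | nil => exact le_rfl
  | cons a p ih =>
    rw [List.all_cons, Bool.and_eq_true] at h
    exact add_nonneg (Coeff.eval_nonneg a _ (fun x hx => he x (List.mem_of_mem_tail hx)) h.1)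
      (mul_nonneg he0 (ih h.2))

instance : Coeff (List α) where
  zero := []
  add := addList Coeff.add
  mul := mulList Coeff.isZero Coeff.zero Coeff.add Coeff.mul
  scale := scaleList Coeff.scale
  isZero p := p.all Coeff.isZero
  nonneg p := p.all Coeff.nonneg
  eval := evalList
  eval_zero _ := rfl
  eval_add := evalList_add
  eval_mul := evalList_mul
  eval_scale := evalList_scale
  eval_of_isZero := evalList_of_all_isZero
  eval_nonneg := evalList_nonneg

end Lists

open Coeff

/-- Polynomials in two variables, here the barycentric coordinates `x₁, x₂` of a point. -/
abbrev P2 := List (List ℤ)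

/-- Polynomials in three variables. -/
abbrev P3 := List P2

/-- Equality of polynomials. -/
def eqv {α : Type} [Coeff α] (p q : α) : Bool := isZero (add p (scale (-1) q))

theorem eval_eq_of_eqv {α : Type} [Coeff α] {p q : α} (h : eqv p q = true) (e : List ℝ) :
    eval p e = eval q e := by
  have := eval_of_isZero _ e h
  rw [eval_add, eval_scale] at this
  push_cast at this
  linarith

theorem eval_nil {α : Type} [Coeff α] (e : List ℝ) : eval ([] : List α) e = 0 := rfl

theorem eval_cons {α : Type} [Coeff α] (a : α) (p : List α) (e : List ℝ) :
    eval (a :: p) e = eval a e.tail + e.headD 0 * eval p e := rfl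

theorem eval_int (z : ℤ) (e : List ℝ) : eval z e = z := rfl

theorem eval_getD_map {α : Type} [Coeff α] (f : α → α) (c : ℝ) (e : List ℝ)
    (hf : ∀ a, eval (f a) e = c * eval a e) (l : List α) (k : ℕ) :
    eval ((l.map f).getD k zero) e = c * eval (l.getD k zero) e := by
  simp only [List.getD_eq_getElem?_getD, List.getElem?_map]
  cases l[k]? with
  | none => simp [eval_zero]
  | some a => simp [hf]

theorem eval_getD_addList {α : Type} [Coeff α] (l m : List α) (k : ℕ) (e : List ℝ) :
    eval ((addList add l m).getD k zero) e = eval (l.getD k zero) e + eval (m.getD k zero) e := by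
  induction l generalizing m k with
  | nil => simp [addList, eval_zero]
  | cons a l ih =>
    cases m with
    | nil => simp [addList, eval_zero]
    | cons b m =>
      cases k with
      | zero => simp [addList, eval_add]
      | succ k => simpa [addList] using ih m k

end PS12

namespace PS12

open Coeff

/-! ### The polynomial pieces of the simplex splines -/

/-- The affine function `a + b x₁ + c x₂`. -/
def affine (f : ℤ × ℤ × ℤ) : P2 := [[f.1, f.2.2], [f.2.1]]

/-- A nondegenerate triangle with vertices among the corners and edge midpoints, with its
barycentric coordinates, the inverse of its relative area, and the set of faces it contains,
as a bit mask. -/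
structure Tri where
  i : Fin 10
  j : Fin 10
  k : Fin 10
  fi : ℤ × ℤ × ℤ
  fj : ℤ × ℤ × ℤ
  fk : ℤ × ℤ × ℤ
  ratio : ℤ
  mask : ℕ

/-- The nondegenerate triangles, in lexicographic order. -/
def tris : List Tri := [
  ⟨0, 1, 2, (1, -1, -1), (0, 1, 0), (0, 0, 1), 1, 4095⟩,
  ⟨0, 1, 4, (1, -1, -1), (0, 1, -1), (0, 0, 2), 2, 461⟩,
  ⟨0, 1, 5, (1, -1, -2), (0, 1, 0), (0, 0, 2), 2, 2247⟩,
  ⟨0, 2, 3, (1, -2, -1), (0, 0, 1), (0, 2, 0), 2, 3171⟩,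
  ⟨0, 2, 4, (1, -1, -1), (0, -1, 1), (0, 2, 0), 2, 3634⟩,
  ⟨0, 3, 4, (1, -2, 0), (0, 2, -2), (0, 0, 2), 4, 449⟩,
  ⟨0, 3, 5, (1, -2, -2), (0, 2, 0), (0, 0, 2), 4, 3⟩,
  ⟨0, 4, 5, (1, 0, -2), (0, 2, 0), (0, -2, 2), 4, 3586⟩,
  ⟨1, 2, 3, (-1, 2, 1), (0, 0, 1), (2, -2, -2), 2, 924⟩,
  ⟨1, 2, 5, (0, 1, 0), (-1, 1, 2), (2, -2, -2), 2, 1848⟩,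
  ⟨1, 3, 4, (-1, 2, 0), (2, -2, -2), (0, 0, 2), 4, 12⟩,
  ⟨1, 3, 5, (-1, 2, 2), (2, -2, -4), (0, 0, 2), 4, 2244⟩,
  ⟨1, 4, 5, (1, 0, -2), (-2, 2, 4), (2, -2, -2), 4, 1800⟩,
  ⟨2, 3, 4, (1, -2, 0), (2, -2, -2), (-2, 4, 2), 4, 912⟩,
  ⟨2, 3, 5, (-1, 2, 2), (0, 2, 0), (2, -4, -2), 4, 3168⟩,
  ⟨2, 4, 5, (-1, 0, 2), (0, 2, 0), (2, -2, -2), 4, 48⟩,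
  ⟨3, 4, 5, (1, 0, -2), (-1, 2, 2), (1, -2, 0), 4, 4032⟩]

/-- The multiplicity of the knot `i` in the knot multiset encoded by the hexadecimal digits
of `c`. -/
def mult (c i : ℕ) : ℕ := c / 16 ^ i % 16

/-- The counterpart of `knotTriple`: the order of `tris` makes both searches stop at the same
triple. -/
def firstTri (c : ℕ) : Option Tri :=
  tris.find? fun t =>
    Nat.ble 1 (mult c t.i.val) && Nat.ble 1 (mult c t.j.val) && Nat.ble 1 (mult c t.k.val)

/-- The polynomials representing the simplex spline of degree `d` on the twelve faces.  The pattern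
matching on the code makes the kernel evaluate it, so that repeated calls are found in its cache. -/
def pieces : ℕ → ℕ → List P2
  | _, 0 => []
  | 0, c + 1 => match firstTri (c + 1) with
    | none => []
    | some t => (List.range 12).map fun k => if t.mask.testBit k then [[t.ratio]] else []
  | d + 1, c + 1 => match firstTri (c + 1) with
    | none => []
    | some t =>
      addList add ((pieces d (c + 1 - 16 ^ t.i.val)).map (mul (affine t.fi)))
        (addList add ((pieces d (c + 1 - 16 ^ t.j.val)).map (mul (affine t.fj)))
          ((pieces d (c + 1 - 16 ^ t.k.val)).map (mul (affine t.fk))))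

/-- The six lines that form the split, each with the set of faces on its positive side. -/
def splitLine : Fin 6 → (ℤ × ℤ × ℤ) × ℕ := ![
  ((0, 1, -1), 461),
  ((1, -1, -2), 2247),
  ((1, -2, -1), 3171),
  ((1, -2, -2), 3),
  ((-1, 2, 0), 12),
  ((-1, 0, 2), 48)]

def coeffAt (p : P2) (i j : ℕ) : ℤ := (p.getD i []).getD j 0

/-- The affine cofactor `q` of a multiple `q ℓ ^ 4` of the fourth power of `ℓ = x₁ - x₂`. -/
def cofactorDiag (p : P2) : P2 := [[coeffAt p 4 0, coeffAt p 0 5], [coeffAt p 5 0]]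

/-- The affine cofactor `q` of a multiple `q ℓ ^ 4` of the fourth power of `ℓ`, when the constant
term of `ℓ` is `± 1`. -/
def cofactor (l : ℤ × ℤ × ℤ) (p : P2) : P2 :=
  -- For `ℓ = l₀ + l₁ x₁ + l₂ x₂` with `l₀ = ± 1`, the expansion `ℓ ^ 4 = 1 + 4 l₀ (l₁ x₁ + l₂ x₂) +
  -- ⋯` shows that the linear coefficients of `q` are those of `p` minus `4 a l₀ lᵢ`.
  let a := coeffAt p 0 0
  [[a, coeffAt p 0 1 - 4 * a * l.1 * l.2.2], [coeffAt p 1 0 - 4 * a * l.1 * l.2.1]]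

/-- The polynomial `p` and the affine functions `q₁, …, q₆` in the representation
`p + ∑ qᵢ max (ℓᵢ, 0) ^ 4` of the spline with the pieces `l`. -/
def truncated (l : List P2) : List P2 :=
  -- Face 9 lies on the nonpositive side of all six lines and supplies `p`. Each jump compares two
  -- faces separated by exactly one of the lines.
  let jump (k m : ℕ) : P2 := add (l.getD k []) (scale (-1) (l.getD m []))
  [l.getD 9 [], cofactorDiag (jump 8 9), cofactor (splitLine 1).1 (jump 11 10),
    cofactor (splitLine 2).1 (jump 10 9), cofactor (splitLine 3).1 (jump 0 6),
    cofactor (splitLine 4).1 (jump 3 8), cofactor (splitLine 5).1 (jump 4 9)]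

def pow4 {α : Type} [Coeff α] (p : α) : α := mul (mul p p) (mul p p)

/-- The polynomial to which the truncated power representation reduces on the face `k`. -/
def truncatedPiece (t : List P2) (k : ℕ) : P2 :=
  (List.finRange 6).foldr (fun i r =>
    if (splitLine i).2.testBit k then
      add (mul (t.getD (i + 1) []) (pow4 (affine (splitLine i).1))) r else r) (t.getD 0 [])

/-- `truncated` reads its candidates off a few coefficients of a few faces. This check on all twelve
faces shows that the jumps really are multiples of fourth powers and that they fit together. -/
def checkTruncated (c : ℕ) : Bool :=
  (List.range 12).all fun k =>
    eqv ((pieces 5 c).getD k []) (truncatedPiece (truncated (pieces 5 c)) k)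

/-! ### Nonnegativity -/

/-- Twelve times the barycentric coordinates of the vertices of the split. -/
def bary12 : Fin 10 → ℤ × ℤ × ℤ :=
  ![(12, 0, 0), (0, 12, 0), (0, 0, 12), (6, 6, 0), (0, 6, 6), (6, 0, 6), (6, 3, 3), (3, 6, 3),
    (3, 3, 6), (4, 4, 4)]

def linear (a b c : ℤ) : P3 := [[[0, c], [b]], [[a]]]

def power (p : P3) : ℕ → P3
  | 0 => [[[1]]]
  | n + 1 => mul p (power p n)

/-- The homogeneous binary form with the given coefficients. -/
def homogRow : ℕ → List ℤ → P2
  | _, [] => []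
  | d, a :: l => (List.replicate d 0 ++ [a]) :: homogRow (d - 1) l

/-- The homogeneous ternary form of degree `d` with the given coefficients. -/
def homog : ℕ → P2 → P3
  | _, [] => []
  | d, r :: p => homogRow d r :: homog (d - 1) p

def coeffX (k : Fin 12) (f : ℤ × ℤ × ℤ → ℤ) : P3 :=
  linear (f (bary12 (faceVertices k 0))) (f (bary12 (faceVertices k 1)))
    (f (bary12 (faceVertices k 2)))

/-- The monomial `x₁ ^ i x₂ ^ j` as a homogeneous form of degree five in the barycentric coordinates
with respect to the face `k`, divided by twelve. -/
def monomialForm (k : Fin 12) (i j : ℕ) : P3 :=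
  mul (power (coeffX k fun w => w.2.1) i)
    (mul (power (coeffX k fun w => w.2.2) j) (power (linear 12 12 12) (5 - i - j)))

/-- In a form of degree five two exponents determine the third, so the last entry of each innermost
list carries all the information. `homog` restores the form, and `checkTable` confirms that nothing
is lost. -/
def monomialTable (k : Fin 12) : List (List P2) :=
  (List.range 6).map fun i => (List.range (6 - i)).map fun j =>
    (monomialForm k i j).map fun p => p.map fun l => l.getLastD 0

def checkTable (k : Fin 12) : Bool :=
  (List.range 6).all fun i => (List.range (6 - i)).all fun j =>
    eqv (homog 5 (((monomialTable k).getD i []).getD j [])) (monomialForm k i j)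

/-- Together with `combine` this changes coordinates to those of a face, using the tabulated images
of the monomials: only integer multiples and sums remain to be formed. -/
def combineRow : List P2 → List ℤ → P2
  | M :: Ms, a :: l => add (scale a M) (combineRow Ms l)
  | _, _ => []

def combine : List (List P2) → P2 → P2
  | M :: Ms, r :: p => add (combineRow M r) (combine Ms p)
  | _, _ => []

/-- Whether `p` has degree at most `d`. -/
def degreeLE (d : ℕ) (p : P2) : Bool :=
  Nat.ble p.length (d + 1) &&
    (List.range (d + 1)).all fun i => Nat.ble (p.getD i []).length (d + 1 - i)

/-- The coefficients tested are, up to positive factors, the Bernstein coefficients on the face. The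
degree test ensures that every monomial of the piece occurs in the table. -/
def checkNonneg (c : ℕ) : Bool :=
  (List.finRange 12).all fun k => degreeLE 5 ((pieces 5 c).getD k []) &&
    nonneg (combine (monomialTable k) ((pieces 5 c).getD k []))

/-! ### The Marsden identity -/

/-- A basis element: four times its weight, the code of its knots, and its dual points. -/
structure Code where
  weight : ℤ
  knots : ℕ
  dual : List (Fin 10)

/-- The symmetry classes are written out with numerals so that they can be evaluated; `basis_eq`
compares them with the definition. The last hexadecimal digit is the multiplicity of the first
corner. -/
def orbit_a : List Code := [
  ⟨1, 0x110600, [2, 2, 2, 2, 2]⟩,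
  ⟨1, 0x011060, [1, 1, 1, 1, 1]⟩,
  ⟨1, 0x101006, [0, 0, 0, 0, 0]⟩]

def orbit_b : List Code := [
  ⟨1, 0x210500, [2, 2, 2, 2, 5]⟩,
  ⟨1, 0x120500, [2, 2, 2, 2, 4]⟩,
  ⟨1, 0x021050, [1, 1, 1, 1, 4]⟩,
  ⟨1, 0x012050, [1, 1, 1, 1, 3]⟩,
  ⟨1, 0x201005, [0, 0, 0, 0, 5]⟩,
  ⟨1, 0x102005, [0, 0, 0, 0, 3]⟩]

def orbit_e : List Code := [
  ⟨2, 0x120410, [2, 2, 2, 4, 4]⟩,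
  ⟨2, 0x021140, [1, 1, 1, 4, 4]⟩,
  ⟨2, 0x210401, [2, 2, 2, 5, 5]⟩,
  ⟨2, 0x012041, [1, 1, 1, 3, 3]⟩,
  ⟨2, 0x201104, [0, 0, 0, 5, 5]⟩,
  ⟨2, 0x102014, [0, 0, 0, 3, 3]⟩]

def orbit_f : List Code := [
  ⟨2, 0x120320, [1, 2, 2, 4, 4]⟩,
  ⟨2, 0x021230, [1, 1, 2, 4, 4]⟩,
  ⟨2, 0x210302, [0, 2, 2, 5, 5]⟩,
  ⟨2, 0x012032, [0, 1, 1, 3, 3]⟩,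
  ⟨2, 0x201203, [0, 0, 2, 5, 5]⟩,
  ⟨2, 0x102023, [0, 0, 1, 3, 3]⟩]

def orbit_g : List Code := [
  ⟨3, 0x121220, [1, 2, 4, 4, 9]⟩,
  ⟨3, 0x211202, [0, 2, 5, 5, 9]⟩,
  ⟨3, 0x112022, [0, 1, 3, 3, 9]⟩]

def orbit_g' : List Code := [
  ⟨1, 0x121220, [0, 1, 2, 4, 4]⟩,
  ⟨1, 0x211202, [0, 1, 2, 5, 5]⟩,
  ⟨1, 0x112022, [0, 1, 2, 3, 3]⟩]

def orbit_l : List Code := [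
  ⟨4, 0x110411, [2, 2, 2, 4, 5]⟩,
  ⟨4, 0x011141, [1, 1, 1, 3, 4]⟩,
  ⟨4, 0x101114, [0, 0, 0, 3, 5]⟩]

def orbit_n : List Code := [
  ⟨3, 0x110222, [0, 1, 2, 2, 9]⟩,
  ⟨3, 0x101222, [0, 0, 1, 2, 9]⟩,
  ⟨3, 0x011222, [0, 1, 1, 2, 9]⟩]

def orbit_o : List Code := [
  ⟨3, 0x111221, [0, 1, 2, 4, 9]⟩,
  ⟨3, 0x111212, [0, 1, 2, 5, 9]⟩,
  ⟨3, 0x111122, [0, 1, 2, 3, 9]⟩]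

def orbit_q : List Code := [
  ⟨4, 0x020321, [1, 2, 2, 4, 4]⟩,
  ⟨4, 0x020231, [1, 1, 2, 4, 4]⟩,
  ⟨4, 0x200312, [0, 2, 2, 5, 5]⟩,
  ⟨4, 0x002132, [0, 1, 1, 3, 3]⟩,
  ⟨4, 0x200213, [0, 0, 2, 5, 5]⟩,
  ⟨4, 0x002123, [0, 0, 1, 3, 3]⟩]

def orbit_r : List Code := [
  ⟨2, 0x210311, [0, 2, 2, 4, 5]⟩,
  ⟨2, 0x120311, [1, 2, 2, 4, 5]⟩,
  ⟨2, 0x021131, [1, 1, 2, 3, 4]⟩,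
  ⟨2, 0x012131, [0, 1, 1, 3, 4]⟩,
  ⟨2, 0x201113, [0, 0, 2, 3, 5]⟩,
  ⟨2, 0x102113, [0, 0, 1, 3, 5]⟩]

def orbit_s : List Code := [
  ⟨3, 0x120221, [1, 2, 2, 4, 9]⟩,
  ⟨3, 0x021221, [1, 1, 2, 4, 9]⟩,
  ⟨3, 0x210212, [0, 2, 2, 5, 9]⟩,
  ⟨3, 0x201212, [0, 0, 2, 5, 9]⟩,
  ⟨3, 0x102122, [0, 0, 1, 3, 9]⟩,
  ⟨3, 0x012122, [0, 1, 1, 3, 9]⟩]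

def orbit_s' : List Code := [
  ⟨1, 0x120221, [0, 1, 2, 2, 4]⟩,
  ⟨1, 0x021221, [0, 1, 1, 2, 4]⟩,
  ⟨1, 0x210212, [0, 1, 2, 2, 5]⟩,
  ⟨1, 0x201212, [0, 0, 1, 2, 5]⟩,
  ⟨1, 0x102122, [0, 0, 1, 2, 3]⟩,
  ⟨1, 0x012122, [0, 1, 1, 2, 3]⟩]

def orbit_t : List Code := [
  ⟨3, 0x211211, [0, 2, 4, 5, 9]⟩,
  ⟨3, 0x121211, [1, 2, 4, 5, 9]⟩,
  ⟨3, 0x121121, [1, 2, 3, 4, 9]⟩,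
  ⟨3, 0x112121, [0, 1, 3, 4, 9]⟩,
  ⟨3, 0x211112, [0, 2, 3, 5, 9]⟩,
  ⟨3, 0x112112, [0, 1, 3, 5, 9]⟩]

def orbit_t' : List Code := [
  ⟨2, 0x211211, [0, 1, 2, 5, 8]⟩,
  ⟨2, 0x121211, [0, 1, 2, 4, 8]⟩,
  ⟨2, 0x121121, [0, 1, 2, 4, 7]⟩,
  ⟨2, 0x112121, [0, 1, 2, 3, 7]⟩,
  ⟨2, 0x211112, [0, 1, 2, 5, 6]⟩,
  ⟨2, 0x112112, [0, 1, 2, 3, 6]⟩]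

def codes : Fin 6 → List Code := ![
  orbit_a ++ orbit_b ++ orbit_e ++ orbit_f ++ orbit_l ++ orbit_n ++ orbit_r ++ orbit_s,
  orbit_a ++ orbit_b ++ orbit_e ++ orbit_f ++ orbit_l ++ orbit_o ++ orbit_r ++ orbit_s,
  orbit_a ++ orbit_b ++ orbit_e ++ orbit_f ++ orbit_g ++ orbit_l ++ orbit_r ++ orbit_t,
  orbit_a ++ orbit_b ++ orbit_e ++ orbit_l ++ orbit_n ++ orbit_q ++ orbit_r ++ orbit_s',
  orbit_a ++ orbit_b ++ orbit_e ++ orbit_l ++ orbit_o ++ orbit_q ++ orbit_r ++ orbit_s',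
  orbit_a ++ orbit_b ++ orbit_e ++ orbit_g' ++ orbit_l ++ orbit_q ++ orbit_r ++ orbit_t']

/-- The dual polynomial, multiplied by `12 ^ 5`. -/
def dualPoly : List (Fin 10) → P3
  | [] => [[[1]]]
  | j :: D => mul (linear (bary12 j).1 (bary12 j).2.1 (bary12 j).2.2) (dualPoly D)

/-- The product of polynomials in different variables. -/
def outer {α : Type} [Coeff α] (p : P3) (t : α) : List (List (List α)) :=
  p.map fun q => q.map fun r => r.map fun z => scale z t

/-- The polynomial `c₀ x₀ + c₁ x₁ + c₂ x₂`. -/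
def pairing : List (List (List P2)) :=
  [[[[], [[0, 1]]], [[[], [1]]]], [[[[1, -1], [-1]]]]]

/-- The index 0 selects the polynomial parts of the splines, and `i + 1` the cofactors of the `i`-th
truncated power. The variables are `c₀, c₁, c₂`, then `x₁, x₂`. -/
def marsdenSum (i : ℕ) (l : List Code) : List (List (List P2)) :=
  l.foldr (fun b r => add (outer (scale b.weight (dualPoly b.dual))
    ((truncated (pieces 5 b.knots)).getD i [])) r) []

/-- The polynomial parts must add up to the fifth power and the truncated powers must cancel. The
factor 4 clears the weights, and `12 ^ 5` the denominators of the five dual points. -/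
def checkMarsden (n : Fin 6) : Bool :=
  eqv (marsdenSum 0 (codes n)) (scale (4 * 12 ^ 5) (mul pairing (pow4 pairing))) &&
    (List.range 6).all fun i => isZero (marsdenSum (i + 1) (codes n))

/-! ### Verification by evaluation -/

def allKnots : List ℕ := [
  0x210500, 0x120500, 0x110600, 0x120410, 0x121220, 0x120320, 0x021230, 0x021140,
  0x021050, 0x012050, 0x011060, 0x210401, 0x211211, 0x121211, 0x210311, 0x120311,
  0x110411, 0x121121, 0x112121, 0x120221, 0x111221, 0x021221, 0x020321, 0x021131,
  0x012131, 0x020231, 0x012041, 0x011141, 0x211202, 0x210302, 0x211112, 0x112112,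
  0x210212, 0x201212, 0x111212, 0x200312, 0x112022, 0x111122, 0x102122, 0x012122,
  0x110222, 0x101222, 0x011222, 0x012032, 0x002132, 0x201203, 0x201113, 0x102113,
  0x200213, 0x102023, 0x002123, 0x201104, 0x102014, 0x101114, 0x201005, 0x102005,
  0x101006]

/-- The checks form one conjunction so that a single evaluation can share the pieces among them. -/
theorem checks_eq_true :
    (allKnots.all checkTruncated && (List.finRange 12).all checkTable && allKnots.all checkNonneg &&
      (List.finRange 6).all checkMarsden) = true := by
  decide +kernel

end PS12

namespace PS12

/-! ### Barycentric coordinates -/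

theorem mem_triangle_iff {v : Fin 3 → Plane} {x : Plane} :
    x ∈ triangle v ↔ ∃ a b c : ℝ, 0 ≤ a ∧ 0 ≤ b ∧ 0 ≤ c ∧ a + b + c = 1 ∧
      x = a • v 0 + b • v 1 + c • v 2 := by
  rw [triangle, convexHull_range_eq_exists_affineCombination]
  constructor
  · rintro ⟨s, w, hw0, hw1, rfl⟩
    refine ⟨if 0 ∈ s then w 0 else 0, if 1 ∈ s then w 1 else 0, if 2 ∈ s then w 2 else 0,
      ?_, ?_, ?_, ?_, ?_⟩
    · split_ifs with h <;> simp [hw0, h]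
    · split_ifs with h <;> simp [hw0, h]
    · split_ifs with h <;> simp [hw0, h]
    · have := Finset.sum_ite_mem Finset.univ s w
      rw [Finset.univ_inter, hw1, Fin.sum_univ_three] at this
      exact this
    · rw [s.affineCombination_eq_linear_combination v w hw1]
      have := Finset.sum_ite_mem Finset.univ s (fun i => w i • v i)
      rw [Finset.univ_inter, Fin.sum_univ_three] at this
      rw [← this]
      simp only [ite_smul, zero_smul]
  · rintro ⟨a, b, c, ha, hb, hc, h, rfl⟩
    have h1 : ∑ i ∈ Finset.univ, (![a, b, c] : Fin 3 → ℝ) i = 1 := by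
      simpa [Fin.sum_univ_three] using h
    refine ⟨Finset.univ, ![a, b, c], ?_, h1, ?_⟩
    · intro i _
      fin_cases i <;> simpa
    · rw [Finset.univ.affineCombination_eq_linear_combination v _ h1]
      simp [Fin.sum_univ_three]

theorem plane_ext {x y : Plane} (h0 : x 0 = y 0) (h1 : x 1 = y 1) : x = y := by
  ext i
  fin_cases i <;> assumption

/-- The barycentric coordinate of `x` with respect to the second corner. -/
noncomputable def bary₁ (v : Fin 3 → Plane) (x : Plane) : ℝ :=
  orient (v 0) x (v 2) / orient (v 0) (v 1) (v 2)

/-- The barycentric coordinate of `x` with respect to the third corner. -/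
noncomputable def bary₂ (v : Fin 3 → Plane) (x : Plane) : ℝ :=
  orient (v 0) (v 1) x / orient (v 0) (v 1) (v 2)

/-- The values of the variables of the polynomial pieces at the point `x`. -/
noncomputable def env (v : Fin 3 → Plane) (x : Plane) : List ℝ := [bary₁ v x, bary₂ v x]

section

variable {v : Fin 3 → Plane}

theorem coord_eq (hv : orient (v 0) (v 1) (v 2) ≠ 0) (x : Plane) (i : Fin 2) :
    x i = v 0 i + bary₁ v x * (v 1 i - v 0 i) + bary₂ v x * (v 2 i - v 0 i) := by
  unfold bary₁ bary₂
  field_simp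
  unfold orient
  fin_cases i
  · simp only [Fin.zero_eta]; ring
  · simp only [Fin.mk_one]; ring

/-- An affine change of coordinates multiplies signed areas by its determinant. -/
theorem orient_eq (hv : orient (v 0) (v 1) (v 2) ≠ 0) (p q r : Plane) :
    orient p q r = ((bary₁ v q - bary₁ v p) * (bary₂ v r - bary₂ v p) -
      (bary₂ v q - bary₂ v p) * (bary₁ v r - bary₁ v p)) * orient (v 0) (v 1) (v 2) := by
  have h := coord_eq hv
  simp only [orient]
  rw [h p 0, h p 1, h q 0, h q 1, h r 0, h r 1]
  simp only [orient] at *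
  ring

theorem bary_combination (hv : orient (v 0) (v 1) (v 2) ≠ 0) {a b c : ℝ} (h : a + b + c = 1)
    (p q r : Plane) :
    bary₁ v (a • p + b • q + c • r) = a * bary₁ v p + b * bary₁ v q + c * bary₁ v r ∧
      bary₂ v (a • p + b • q + c • r) = a * bary₂ v p + b * bary₂ v q + c * bary₂ v r := by
  obtain rfl : a = 1 - b - c := by linarith
  constructor
  · unfold bary₁
    field_simp
    simp only [orient, PiLp.add_apply, PiLp.smul_apply, smul_eq_mul]
    ring
  · unfold bary₂
    field_simp
    simp only [orient, PiLp.add_apply, PiLp.smul_apply, smul_eq_mul]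
    ring

theorem bary_corner (hv : orient (v 0) (v 1) (v 2) ≠ 0) :
    (bary₁ v (v 0) = 0 ∧ bary₂ v (v 0) = 0) ∧ (bary₁ v (v 1) = 1 ∧ bary₂ v (v 1) = 0) ∧
      (bary₁ v (v 2) = 0 ∧ bary₂ v (v 2) = 1) := by
  unfold bary₁ bary₂
  refine ⟨⟨?_, ?_⟩, ⟨?_, ?_⟩, ⟨?_, ?_⟩⟩ <;> field_simp <;> simp only [orient] <;> ring

theorem mem_triangle_iff_bary (hv : orient (v 0) (v 1) (v 2) ≠ 0) (x : Plane) :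
    x ∈ triangle v ↔ 0 ≤ 1 - bary₁ v x - bary₂ v x ∧ 0 ≤ bary₁ v x ∧ 0 ≤ bary₂ v x := by
  rw [mem_triangle_iff]
  constructor
  · rintro ⟨a, b, c, ha, hb, hc, h, rfl⟩
    obtain ⟨⟨h1, h2⟩, ⟨h3, h4⟩, ⟨h5, h6⟩⟩ := bary_corner hv
    obtain ⟨e1, e2⟩ := bary_combination hv h (v 0) (v 1) (v 2)
    rw [h1, h3, h5] at e1
    rw [h2, h4, h6] at e2
    rw [e1, e2]
    refine ⟨?_, ?_, ?_⟩ <;> linarith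
  · rintro ⟨h0, h1, h2⟩
    refine ⟨_, _, _, h0, h1, h2, by ring, plane_ext ?_ ?_⟩
    · simp only [PiLp.add_apply, PiLp.smul_apply, smul_eq_mul]
      linarith [coord_eq hv x 0]
    · simp only [PiLp.add_apply, PiLp.smul_apply, smul_eq_mul]
      linarith [coord_eq hv x 1]

theorem orient_ne_zero (hv : AffineIndependent ℝ v) : orient (v 0) (v 1) (v 2) ≠ 0 := by
  intro h
  rw [affineIndependent_iff] at hv
  have key : ∀ w : Fin 3 → ℝ, w 0 + w 1 + w 2 = 0 → w 0 • v 0 + w 1 • v 1 + w 2 • v 2 = 0 →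
      ∀ i, w i = 0 := by
    intro w h1 h2 i
    exact hv Finset.univ w (by simpa [Fin.sum_univ_three] using h1)
      (by simpa [Fin.sum_univ_three] using h2) i (Finset.mem_univ i)
  -- If the determinant vanishes, the `i`-th coordinates of the two edge vectors provide the weights
  -- of an affine dependence of the corners, so they are all zero.
  have hv' : ∀ i : Fin 2, ∀ j : Fin 3, (![-(v 2 i - v 0 i) + (v 1 i - v 0 i), v 2 i - v 0 i,
      -(v 1 i - v 0 i)] : Fin 3 → ℝ) j = 0 := by
    intro i
    refine key _ ?_ (plane_ext ?_ ?_)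
    · simp
    all_goals
      simp only [orient] at h
      fin_cases i <;> simp <;> linarith
  have h10 := hv' 0 1
  have h20 := hv' 0 2
  have h11 := hv' 1 1
  have h21 := hv' 1 2
  simp at h10 h20 h11 h21
  -- Now the corners coincide, so the weights `1, -1, 0` are a dependence as well.
  have := key ![1, -1, 0] (by simp) (plane_ext (by simp; linarith) (by simp; linarith)) 0
  simp at this

end

/-! ### Areas -/

/-- The linear map with the columns `p` and `q`. -/
noncomputable def columnMap (p q : Plane) : Plane →ₗ[ℝ] Plane :=
  Matrix.toLin (EuclideanSpace.basisFun (Fin 2) ℝ).toBasis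
    (EuclideanSpace.basisFun (Fin 2) ℝ).toBasis !![p 0, q 0; p 1, q 1]

theorem columnMap_apply (p q x : Plane) : columnMap p q x = x 0 • p + x 1 • q := by
  apply plane_ext <;>
  simp [columnMap, Matrix.toLin_apply, Matrix.mulVec, dotProduct, Fin.sum_univ_two] <;> ring

theorem det_columnMap (p q : Plane) : LinearMap.det (columnMap p q) = p 0 * q 1 - p 1 * q 0 := by
  rw [columnMap, LinearMap.det_toLin, Matrix.det_fin_two]
  simp
  ring

/-- The standard triangle. -/
noncomputable def standardTriangle : Set Plane := triangle ![0, !₂[1, 0], !₂[0, 1]]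

theorem mem_standardTriangle (x : Plane) :
    x ∈ standardTriangle ↔ 0 ≤ 1 - x 0 - x 1 ∧ 0 ≤ x 0 ∧ 0 ≤ x 1 := by
  rw [standardTriangle, mem_triangle_iff_bary (by simp [orient])]
  simp [bary₁, bary₂, orient]

theorem triangle_eq_image (v : Fin 3 → Plane) :
    triangle v = (fun y => v 0 + y) '' (columnMap (v 1 - v 0) (v 2 - v 0) '' standardTriangle) := by
  ext x
  simp only [Set.mem_image, exists_exists_and_eq_and]
  rw [mem_triangle_iff]
  constructor
  · rintro ⟨a, b, c, ha, hb, hc, h, rfl⟩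
    obtain rfl : a = 1 - b - c := by linarith
    refine ⟨!₂[b, c], ?_, ?_⟩
    · rw [mem_standardTriangle]
      simp
      exact ⟨by linarith, hb, hc⟩
    · rw [columnMap_apply]
      apply plane_ext <;> simp <;> ring
  · rintro ⟨y, hy, rfl⟩
    rw [mem_standardTriangle] at hy
    refine ⟨_, _, _, hy.1, hy.2.1, hy.2.2, by ring, ?_⟩
    rw [columnMap_apply]
    apply plane_ext <;> simp <;> ring

/-- Only ratios of areas occur in the splines, so the area of the standard triangle need not be
computed; it has to be positive and finite. -/
theorem volume_triangle (v : Fin 3 → Plane) :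
    volume (triangle v) =
      ENNReal.ofReal |orient (v 0) (v 1) (v 2)| * volume standardTriangle := by
  rw [triangle_eq_image, Set.image_add_left, measure_preimage_add,
    Measure.addHaar_image_linearMap, det_columnMap]
  simp [orient]

theorem isCompact_triangle (v : Fin 3 → Plane) : IsCompact (triangle v) :=
  (Set.finite_range v).isCompact_convexHull (𝕜 := ℝ)

theorem volume_standardTriangle_ne_top : volume standardTriangle ≠ ⊤ :=
  (isCompact_triangle _).measure_lt_top.ne

theorem volume_standardTriangle_ne_zero : volume standardTriangle ≠ 0 := by
  have h0 : Continuous fun x : Plane => x 0 := by fun_prop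
  have h1 : Continuous fun x : Plane => x 1 := by fun_prop
  have ho : IsOpen {x : Plane | 0 < 1 - x 0 - x 1 ∧ 0 < x 0 ∧ 0 < x 1} :=
    ((isOpen_lt continuous_const ((continuous_const.sub h0).sub h1)).inter
      ((isOpen_lt continuous_const h0).inter (isOpen_lt continuous_const h1)))
  have hne : {x : Plane | 0 < 1 - x 0 - x 1 ∧ 0 < x 0 ∧ 0 < x 1}.Nonempty :=
    ⟨!₂[1 / 3, 1 / 3], by norm_num⟩
  refine ((ho.measure_pos volume hne).trans_le (measure_mono ?_)).ne'
  intro x hx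
  exact (mem_standardTriangle x).2 ⟨hx.1.le, hx.2.1.le, hx.2.2.le⟩

theorem area_triangle (v : Fin 3 → Plane) :
    area (triangle v) = |orient (v 0) (v 1) (v 2)| * area standardTriangle := by
  rw [area, volume_triangle, ENNReal.toReal_mul, ENNReal.toReal_ofReal (abs_nonneg _), area]

theorem area_standardTriangle_pos : 0 < area standardTriangle :=
  ENNReal.toReal_pos volume_standardTriangle_ne_zero volume_standardTriangle_ne_top

end PS12

namespace PS12

open Coeff

/-! ### The recursion in terms of the pieces -/

section

variable {v : Fin 3 → Plane}

theorem bary_vertex (hv : orient (v 0) (v 1) (v 2) ≠ 0) (j : Fin 10) :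
    bary₁ v (vertex v j) = ((bary12 j).2.1 : ℝ) / 12 ∧
      bary₂ v (vertex v j) = ((bary12 j).2.2 : ℝ) / 12 := by
  obtain ⟨⟨h1, h2⟩, ⟨h3, h4⟩, ⟨h5, h6⟩⟩ := bary_corner hv
  have key : ∀ a b c : ℝ, a + b + c = 1 → ∀ y : Plane, y = a • v 0 + b • v 1 + c • v 2 →
      bary₁ v y = b ∧ bary₂ v y = c := by
    rintro a b c h y rfl
    obtain ⟨e1, e2⟩ := bary_combination hv h (v 0) (v 1) (v 2)
    rw [e1, e2, h1, h2, h3, h4, h5, h6]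
    constructor <;> ring
  have := key ((bary12 j).1 / 12) ((bary12 j).2.1 / 12) ((bary12 j).2.2 / 12)
    (by fin_cases j <;> norm_num [bary12]) (vertex v j) (by
      fin_cases j <;> apply plane_ext <;> simp [vertex, bary12] <;> ring)
  exact this

/-- The signed area of the triangle of the vertices `i, j, k`, relative to `1 / 144` of the
area of the macrotriangle. -/
def det12 (i j k : Fin 10) : ℤ :=
  ((bary12 j).2.1 - (bary12 i).2.1) * ((bary12 k).2.2 - (bary12 i).2.2) -
    ((bary12 j).2.2 - (bary12 i).2.2) * ((bary12 k).2.1 - (bary12 i).2.1)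

theorem orient_vertex (hv : orient (v 0) (v 1) (v 2) ≠ 0) (i j k : Fin 10) :
    orient (vertex v i) (vertex v j) (vertex v k) =
      det12 i j k / 144 * orient (v 0) (v 1) (v 2) := by
  rw [orient_eq hv]
  simp only [bary_vertex hv, det12]
  push_cast
  ring

theorem orient_vertex_eq_zero_iff (hv : orient (v 0) (v 1) (v 2) ≠ 0) (i j k : Fin 10) :
    orient (vertex v i) (vertex v j) (vertex v k) = 0 ↔ det12 i j k = 0 := by
  rw [orient_vertex hv]
  simp [hv]

theorem eval_affine (f : ℤ × ℤ × ℤ) (x y : ℝ) :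
    eval (affine f) [x, y] = f.1 + f.2.1 * x + f.2.2 * y := by
  simp only [affine, eval_cons, eval_nil, eval_int, List.tail_cons, List.headD_cons]
  ring

/-- Whether `f` is the barycentric coordinate that vanishes at the vertices `j` and `k`, in a
triangle of relative signed area `d / 144`. -/
def isCoordinate (f : ℤ × ℤ × ℤ) (d : ℤ) (j k : Fin 10) : Prop :=
  f.1 * d = (bary12 j).2.1 * (bary12 k).2.2 - (bary12 j).2.2 * (bary12 k).2.1 ∧
    f.2.1 * d = 12 * ((bary12 j).2.2 - (bary12 k).2.2) ∧
    f.2.2 * d = 12 * ((bary12 k).2.1 - (bary12 j).2.1)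

instance (f : ℤ × ℤ × ℤ) (d : ℤ) (j k : Fin 10) : Decidable (isCoordinate f d j k) :=
  inferInstanceAs (Decidable (_ ∧ _ ∧ _))

/-- Twelve times the value of an affine function at a vertex. -/
def value12 (f : ℤ × ℤ × ℤ) (j : Fin 10) : ℤ :=
  12 * f.1 + f.2.1 * (bary12 j).2.1 + f.2.2 * (bary12 j).2.2

theorem tris_coordinates : ∀ t ∈ tris, det12 t.i t.j t.k ≠ 0 ∧
    isCoordinate t.fi (det12 t.i t.j t.k) t.j t.k ∧
    isCoordinate t.fj (det12 t.i t.j t.k) t.k t.i ∧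
    isCoordinate t.fk (det12 t.i t.j t.k) t.i t.j ∧
    t.ratio * |det12 t.i t.j t.k| = 144 := by
  decide +kernel

theorem tris_lt : ∀ t ∈ tris, t.i < t.j ∧ t.j < t.k ∧ t.k < 6 := by
  decide +kernel

theorem tris_mask : ∀ t ∈ tris, ∀ k : Fin 12, t.mask.testBit k = true ↔
    ∀ m : Fin 3, 0 ≤ value12 t.fi (faceVertices k m) ∧ 0 ≤ value12 t.fj (faceVertices k m) ∧
      0 ≤ value12 t.fk (faceVertices k m) := by
  decide +kernel

theorem exists_mem_tris : ∀ a b c : Fin 10, a < 6 → b < 6 → c < 6 → det12 a b c ≠ 0 →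
    ∃ t ∈ tris, t.i ∈ [a, b, c] ∧ t.j ∈ [a, b, c] ∧ t.k ∈ [a, b, c] := by
  decide +kernel

/-- This equality of lists includes the order, which is why the first noncollinear triple of knots
is also the first hit in `tris`. -/
theorem filter_triples : (triples.filter fun t =>
      decide (t.1 < 6 ∧ t.2.1 < 6 ∧ t.2.2 < 6 ∧ det12 t.1 t.2.1 t.2.2 ≠ 0)) =
    tris.map fun t => (t.i, t.j, t.k) := by
  decide +kernel

theorem eval_of_isCoordinate (hv : orient (v 0) (v 1) (v 2) ≠ 0) {f : ℤ × ℤ × ℤ} {d : ℤ}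
    (hd : d ≠ 0) {j k : Fin 10} (h : isCoordinate f d j k) (x : Plane) :
    eval (affine f) (env v x) =
      orient x (vertex v j) (vertex v k) / (d / 144 * orient (v 0) (v 1) (v 2)) := by
  have hd' : (d : ℝ) ≠ 0 := by exact_mod_cast hd
  rw [env, eval_affine, orient_eq hv, eq_div_iff (by positivity)]
  simp only [bary_vertex hv]
  obtain ⟨h1, h2, h3⟩ := h
  have h1' := congrArg (Int.cast : ℤ → ℝ) h1
  have h2' := congrArg (Int.cast : ℤ → ℝ) h2
  have h3' := congrArg (Int.cast : ℤ → ℝ) h3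
  push_cast at h1' h2' h3'
  linear_combination (orient (v 0) (v 1) (v 2) / 144) *
    (h1' + bary₁ v x * h2' + bary₂ v x * h3')

theorem eval_coordinates (hv : orient (v 0) (v 1) (v 2) ≠ 0) {t : Tri} (ht : t ∈ tris)
    (x : Plane) :
    let a := vertex v t.i
    let b := vertex v t.j
    let c := vertex v t.k
    eval (affine t.fi) (env v x) = orient x b c / orient a b c ∧
      eval (affine t.fj) (env v x) = orient a x c / orient a b c ∧
      eval (affine t.fk) (env v x) = orient a b x / orient a b c := by
  obtain ⟨h0, h1, h2, h3, -⟩ := tris_coordinates t ht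
  intro a b c
  rw [eval_of_isCoordinate hv h0 h1, eval_of_isCoordinate hv h0 h2, eval_of_isCoordinate hv h0 h3,
    ← orient_vertex hv]
  refine ⟨rfl, ?_, ?_⟩ <;> congr 1 <;> simp only [orient, a, b, c] <;> ring

theorem eval_vertex (hv : orient (v 0) (v 1) (v 2) ≠ 0) (f : ℤ × ℤ × ℤ) (j : Fin 10) :
    eval (affine f) (env v (vertex v j)) = value12 f j / 12 := by
  rw [env, eval_affine, (bary_vertex hv j).1, (bary_vertex hv j).2, value12]
  push_cast
  ring

theorem hull_triple (a b c : Fin 10) :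
    hull v {a, b, c} = triangle ![vertex v a, vertex v b, vertex v c] := by
  unfold hull triangle
  congr 1
  ext x
  simp [Matrix.range_cons, Set.image, eq_comm]
  tauto

theorem mem_triangle_iff_orient {a b c : Plane} (h : orient a b c ≠ 0) (x : Plane) :
    x ∈ triangle ![a, b, c] ↔ 0 ≤ orient x b c / orient a b c ∧
      0 ≤ orient a x c / orient a b c ∧ 0 ≤ orient a b x / orient a b c := by
  rw [mem_triangle_iff_bary (by simpa using h)]
  have : 1 - bary₁ ![a, b, c] x - bary₂ ![a, b, c] x = orient x b c / orient a b c := by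
    simp only [bary₁, bary₂, Matrix.cons_val]
    field_simp
    simp only [orient]
    ring
  rw [this]
  simp [bary₁, bary₂]

/-- By convexity it suffices to test the three vertices of the face, where the barycentric
coordinates are known rationals. -/
theorem face_subset_hull_iff (hv : orient (v 0) (v 1) (v 2) ≠ 0) {t : Tri} (ht : t ∈ tris)
    (k : Fin 12) : face v k ⊆ hull v {t.i, t.j, t.k} ↔ t.mask.testBit k = true := by
  have hne : orient (vertex v t.i) (vertex v t.j) (vertex v t.k) ≠ 0 := by
    rw [Ne, orient_vertex_eq_zero_iff hv]
    exact (tris_coordinates t ht).1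
  have hc : Convex ℝ (triangle ![vertex v t.i, vertex v t.j, vertex v t.k]) :=
    convex_convexHull ℝ _
  rw [tris_mask t ht k, hull_triple, face, triangle, hc.convexHull_subset_iff,
    Set.range_subset_iff]
  refine forall_congr' fun m => ?_
  have := eval_coordinates hv ht (vertex v (faceVertices k m))
  simp only [eval_vertex hv] at this
  rw [mem_triangle_iff_orient hne, ← this.1, ← this.2.1, ← this.2.2]
  have h12 : ∀ z : ℤ, 0 ≤ (z : ℝ) / 12 ↔ 0 ≤ z := fun z => by
    rw [le_div_iff₀ (by norm_num)]
    simp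
  simp only [h12]

theorem area_hull_ne_zero {K : Multiset (Fin 10)} {i j k : Fin 10} (hi : i ∈ K) (hj : j ∈ K)
    (hk : k ∈ K) (h : orient (vertex v i) (vertex v j) (vertex v k) ≠ 0) :
    area (hull v K) ≠ 0 := by
  have hsub : triangle ![vertex v i, vertex v j, vertex v k] ⊆ hull v K := by
    refine convexHull_mono (Set.range_subset_iff.2 fun m => ?_)
    fin_cases m
    exacts [⟨i, hi, rfl⟩, ⟨j, hj, rfl⟩, ⟨k, hk, rfl⟩]
  have hfin : volume (hull v K) ≠ ⊤ :=
    (Set.Finite.isCompact_convexHull (𝕜 := ℝ)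
      ((Set.toFinite {j | j ∈ K}).image (vertex v))).measure_lt_top.ne
  have hpos : 0 < area (triangle ![vertex v i, vertex v j, vertex v k]) := by
    rw [area_triangle]
    exact mul_pos (abs_pos.2 (by simpa using h)) area_standardTriangle_pos
  exact (hpos.trans_le (ENNReal.toReal_mono hfin (measure_mono hsub))).ne'

end

/-! ### Knot multisets as hexadecimal numerals, and the recursion on them -/

/-- The knot multiset `K` consists of corners and edge midpoints and is encoded by `c`. -/
def Encodes (c : ℕ) (K : Multiset (Fin 10)) : Prop :=
  ∀ j : Fin 10, K.count j = if j < 6 then mult c j else 0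

/-- The subtraction causes no borrow because the `i`-th digit is positive. -/
theorem mult_sub {c i : ℕ} (hi : i < 6) (h : 1 ≤ mult c i) {j : ℕ} (hj : j < 6) :
    mult (c - 16 ^ i) j = if j = i then mult c j - 1 else mult c j := by
  unfold mult at *
  interval_cases i <;> interval_cases j <;> norm_num at * <;> omega

theorem Encodes.erase {c : ℕ} {K : Multiset (Fin 10)} (h : Encodes c K) {i : Fin 10}
    (hi : i < 6) (h1 : 1 ≤ mult c i) : Encodes (c - 16 ^ i.val) (K.erase i) := by
  intro j
  have hj := h j
  by_cases hj6 : j < 6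
  · rw [if_pos hj6, mult_sub hi h1 hj6]
    rw [if_pos hj6] at hj
    by_cases hij : j = i
    · subst hij
      rw [Multiset.count_erase_self, hj, if_pos rfl]
    · rw [Multiset.count_erase_of_ne hij, hj, if_neg (Fin.val_ne_of_ne hij)]
  · rw [if_neg hj6] at hj ⊢
    have : j ≠ i := by rintro rfl; exact hj6 hi
    rw [Multiset.count_erase_of_ne this, hj]

theorem Encodes.mem_iff {c : ℕ} {K : Multiset (Fin 10)} (h : Encodes c K) {i : Fin 10}
    (hi : i < 6) : i ∈ K ↔ 1 ≤ mult c i := by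
  rw [← Multiset.one_le_count_iff_mem, h i, if_pos hi]

theorem Encodes.lt {c : ℕ} {K : Multiset (Fin 10)} (h : Encodes c K) {i : Fin 10}
    (hi : i ∈ K) : i < 6 := by
  by_contra h6
  have := h i
  rw [if_neg h6, Multiset.count_eq_zero] at this
  exact this hi

theorem knotTriple_eq {v : Fin 3 → Plane} (hv : orient (v 0) (v 1) (v 2) ≠ 0) {c : ℕ}
    {K : Multiset (Fin 10)} (h : Encodes c K) :
    knotTriple v K = (firstTri c).map fun t => (t.i, t.j, t.k) := by
  classical
  have hmap : (firstTri c).map (fun t => (t.i, t.j, t.k)) =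
      (tris.map fun t => (t.i, t.j, t.k)).find? fun t =>
        Nat.ble 1 (mult c t.1.val) && Nat.ble 1 (mult c t.2.1.val) &&
          Nat.ble 1 (mult c t.2.2.val) := by
    rw [List.find?_map]
    rfl
  rw [hmap, ← filter_triples, List.find?_filter, knotTriple]
  congr 1
  funext t
  rw [Bool.eq_iff_iff]
  simp only [decide_eq_true_eq, Bool.and_eq_true, Nat.ble_eq, Ne,
    orient_vertex_eq_zero_iff hv]
  constructor
  · rintro ⟨h1, h2, h3, h4⟩
    exact ⟨⟨h.lt h1, h.lt h2, h.lt h3, h4⟩,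
      ⟨(h.mem_iff (h.lt h1)).1 h1, (h.mem_iff (h.lt h2)).1 h2⟩, (h.mem_iff (h.lt h3)).1 h3⟩
  · rintro ⟨⟨l1, l2, l3, h4⟩, ⟨h1, h2⟩, h3⟩
    exact ⟨(h.mem_iff l1).2 h1, (h.mem_iff l2).2 h2, (h.mem_iff l3).2 h3, h4⟩

theorem firstTri_some {c : ℕ} {t : Tri} (h : firstTri c = some t) :
    t ∈ tris ∧ 1 ≤ mult c t.i ∧ 1 ≤ mult c t.j ∧ 1 ≤ mult c t.k := by
  refine ⟨List.mem_of_find?_eq_some h, ?_⟩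
  have := List.find?_some h
  simpa only [Bool.and_eq_true, Nat.ble_eq, and_assoc] using this

theorem firstTri_zero : firstTri 0 = none := by decide +kernel

theorem pieces_of_none {c : ℕ} (d : ℕ) (h : firstTri c = none) : pieces d c = [] := by
  cases c with
  | zero => cases d <;> rfl
  | succ c => cases d <;> simp [pieces, h]

theorem pieces_zero {c : ℕ} {t : Tri} (h : firstTri c = some t) : pieces 0 c =
    (List.range 12).map fun k => if t.mask.testBit k then [[t.ratio]] else [] := by
  cases c with
  | zero => simp [firstTri_zero] at h
  | succ c => simp [pieces, h]

theorem pieces_succ {c : ℕ} {t : Tri} (d : ℕ) (h : firstTri c = some t) : pieces (d + 1) c =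
    addList add ((pieces d (c - 16 ^ t.i.val)).map (mul (affine t.fi)))
      (addList add ((pieces d (c - 16 ^ t.j.val)).map (mul (affine t.fj)))
        ((pieces d (c - 16 ^ t.k.val)).map (mul (affine t.fk)))) := by
  cases c with
  | zero => simp [firstTri_zero] at h
  | succ c => simp [pieces, h]

theorem area_hull_eq_zero {v : Fin 3 → Plane} (hv : orient (v 0) (v 1) (v 2) ≠ 0) {c : ℕ}
    {K : Multiset (Fin 10)} (hK : Encodes c K) (hcard : K.card = 3) (h : firstTri c = none) :
    area (hull v K) = 0 := by
  obtain ⟨x, y, z, rfl⟩ := Multiset.card_eq_three.1 hcard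
  rw [hull_triple, area_triangle]
  have : orient (vertex v x) (vertex v y) (vertex v z) = 0 := by
    rw [orient_vertex_eq_zero_iff hv]
    by_contra hne
    obtain ⟨t, ht, h1, h2, h3⟩ := exists_mem_tris x y z (hK.lt (by simp)) (hK.lt (by simp))
      (hK.lt (by simp)) hne
    have hmem : ∀ a : Fin 10, a ∈ [x, y, z] → 1 ≤ mult c a := by
      intro a ha
      have ha' : a ∈ ({x, y, z} : Multiset (Fin 10)) := by simpa using ha
      exact (hK.mem_iff (hK.lt ha')).1 ha'
    have := List.find?_eq_none.1 h t ht
    simp only [Bool.and_eq_true, Nat.ble_eq] at this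
    exact this ⟨⟨hmem _ h1, hmem _ h2⟩, hmem _ h3⟩
  simp [this]

theorem eq_triple {K : Multiset (Fin 10)} (hcard : K.card = 3) {i j k : Fin 10} (hi : i ∈ K)
    (hj : j ∈ K) (hk : k ∈ K) (hij : i ≠ j) (hik : i ≠ k) (hjk : j ≠ k) : K = {i, j, k} := by
  have hle : ({i, j, k} : Multiset (Fin 10)) ≤ K := by
    rw [Multiset.le_iff_subset (by simp [hij, hik, hjk])]
    intro a ha
    simp only [Multiset.insert_eq_cons, Multiset.mem_cons, Multiset.mem_singleton] at ha
    rcases ha with rfl | rfl | rfl <;> assumption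
  exact (Multiset.eq_of_le_of_card_le hle (by simp [hcard])).symm

/-- Both sides obey the same recursion with the same affine coefficients. The scheme enters only at
degree zero, where it decides whether the face of `x` lies in the hull, so the face `ρ x` is kept
fixed throughout the induction. -/
theorem simplexSplineAux_eq {v : Fin 3 → Plane} (hv : orient (v 0) (v 1) (v 2) ≠ 0)
    {ρ : Plane → Fin 12} (hρ : IsFaceScheme v ρ) {x : Plane} (hx : x ∈ triangle v) (d : ℕ) {c : ℕ}
    {K : Multiset (Fin 10)} (hK : Encodes c K) (hcard : K.card = d + 3) :
    simplexSplineAux v ρ d K x = eval ((pieces d c).getD (ρ x) zero) (env v x) := by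
  classical
  induction d generalizing c K with
  | zero =>
    rw [simplexSplineAux]
    cases h : firstTri c with
    | none =>
      rw [if_pos (area_hull_eq_zero hv hK hcard h), pieces_of_none 0 h]
      rfl
    | some t =>
      obtain ⟨ht, hi, hj, hk⟩ := firstTri_some h
      obtain ⟨hij, hjk, hk6⟩ := tris_lt t ht
      have hne : orient (vertex v t.i) (vertex v t.j) (vertex v t.k) ≠ 0 := by
        rw [Ne, orient_vertex_eq_zero_iff hv]
        exact (tris_coordinates t ht).1
      have hi' := (hK.mem_iff ((hij.trans hjk).trans hk6)).2 hi
      have hj' := (hK.mem_iff (hjk.trans hk6)).2 hj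
      have hk' := (hK.mem_iff hk6).2 hk
      rw [if_neg (area_hull_ne_zero hi' hj' hk' hne)]
      obtain rfl := eq_triple hcard hi' hj' hk' hij.ne (hij.trans hjk).ne hjk.ne
      have hmem : x ∈ halfOpenHull v ρ {t.i, t.j, t.k} ↔ t.mask.testBit (ρ x) = true := by
        rw [← face_subset_hull_iff hv ht, halfOpenHull]
        simp only [Set.mem_iUnion, Set.mem_ofPred_eq, halfOpenFace, exists_prop]
        constructor
        · rintro ⟨k, h1, -, rfl⟩
          exact h1
        · exact fun h1 => ⟨_, h1, hρ x hx, rfl⟩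
      rw [pieces_zero h]
      have hget : (((List.range 12).map fun k =>
          if t.mask.testBit k then [[t.ratio]] else []).getD (ρ x) (zero : P2)) =
          if t.mask.testBit (ρ x) then [[t.ratio]] else [] := by
        simp [List.getD_eq_getElem?_getD]
      rw [hget, Set.indicator_apply]
      simp only [hmem]
      split_ifs
      · simp only [eval_cons, eval_nil, eval_int]
        obtain ⟨hd, -, -, -, hr⟩ := tris_coordinates t ht
        have hr' := congrArg (Int.cast : ℤ → ℝ) hr
        push_cast at hr'
        have hd' : |(det12 t.i t.j t.k : ℝ)| ≠ 0 := abs_ne_zero.2 (by exact_mod_cast hd)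
        have hD : |orient (v 0) (v 1) (v 2)| ≠ 0 := abs_ne_zero.2 hv
        rw [hull_triple, area_triangle, area_triangle]
        simp only [Matrix.cons_val]
        rw [orient_vertex hv, abs_mul, abs_div]
        have := area_standardTriangle_pos.ne'
        have h144 : |(144 : ℝ)| = 144 := abs_of_pos (by norm_num)
        rw [h144]
        field_simp
        linarith
      · rfl
  | succ d ih =>
    rw [simplexSplineAux]
    cases h : firstTri c with
    | none =>
      have h1 : knotTriple v K = none := by rw [knotTriple_eq hv hK, h]; rfl
      -- Without a noncollinear triple both branches of the definition give zero, so the area of the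
      -- hull is not needed here.
      rw [h1, pieces_of_none _ h]
      simp [zero, eval_nil]
    | some t =>
      obtain ⟨ht, hi, hj, hk⟩ := firstTri_some h
      obtain ⟨hij, hjk, hk6⟩ := tris_lt t ht
      have hj6 := hjk.trans hk6
      have hi6 := hij.trans hj6
      have hne : orient (vertex v t.i) (vertex v t.j) (vertex v t.k) ≠ 0 := by
        rw [Ne, orient_vertex_eq_zero_iff hv]
        exact (tris_coordinates t ht).1
      have hi' := (hK.mem_iff hi6).2 hi
      have hj' := (hK.mem_iff hj6).2 hj
      have hk' := (hK.mem_iff hk6).2 hk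
      have h1 : knotTriple v K = some (t.i, t.j, t.k) := by rw [knotTriple_eq hv hK, h]; rfl
      rw [if_neg (area_hull_ne_zero hi' hj' hk' hne), h1, pieces_succ d h]
      obtain ⟨e1, e2, e3⟩ := eval_coordinates hv ht x
      have hc : ∀ a ∈ K, (K.erase a).card = d + 3 := fun a ha => by
        rw [Multiset.card_erase_of_mem ha, hcard]; rfl
      simp only [← e1, ← e2, ← e3]
      rw [ih (hK.erase hi6 hi) (hc _ hi'), ih (hK.erase hj6 hj) (hc _ hj'),
        ih (hK.erase hk6 hk) (hc _ hk')]
      rw [eval_getD_addList, eval_getD_addList, eval_getD_map _ _ _ (fun a => eval_mul _ a _),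
        eval_getD_map _ _ _ (fun a => eval_mul _ a _), eval_getD_map _ _ _ (fun a => eval_mul _ a _)]
      ring

end PS12

namespace PS12

open Coeff

theorem checkTruncated_of_mem {c : ℕ} (hc : c ∈ allKnots) : checkTruncated c = true := by
  have h := checks_eq_true
  simp only [Bool.and_eq_true] at h
  exact List.all_eq_true.1 h.1.1.1 c hc

theorem checkTable_eq_true (k : Fin 12) : checkTable k = true := by
  have h := checks_eq_true
  simp only [Bool.and_eq_true] at h
  exact List.all_eq_true.1 h.1.1.2 k (List.mem_finRange k)

theorem checkNonneg_of_mem {c : ℕ} (hc : c ∈ allKnots) : checkNonneg c = true := by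
  have h := checks_eq_true
  simp only [Bool.and_eq_true] at h
  exact List.all_eq_true.1 h.1.2 c hc

theorem checkMarsden_eq_true (n : Fin 6) : checkMarsden n = true := by
  have h := checks_eq_true
  simp only [Bool.and_eq_true] at h
  exact List.all_eq_true.1 h.2 n (List.mem_finRange n)

/-! ### The truncated power representation -/

section

variable {v : Fin 3 → Plane}

/-- The weights are barycentric coordinates divided by 12, to make up for the factor 12 in `bary12`.
-/
theorem bary_of_mem_face (hv : orient (v 0) (v 1) (v 2) ≠ 0) {k : Fin 12} {x : Plane}
    (hx : x ∈ face v k) : ∃ s : Fin 3 → ℝ, (∀ m, 0 ≤ s m) ∧ 12 * (s 0 + s 1 + s 2) = 1 ∧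
      bary₁ v x = s 0 * (bary12 (faceVertices k 0)).2.1 + s 1 * (bary12 (faceVertices k 1)).2.1 +
        s 2 * (bary12 (faceVertices k 2)).2.1 ∧
      bary₂ v x = s 0 * (bary12 (faceVertices k 0)).2.2 + s 1 * (bary12 (faceVertices k 1)).2.2 +
        s 2 * (bary12 (faceVertices k 2)).2.2 := by
  obtain ⟨a, b, c, ha, hb, hc, h, rfl⟩ := mem_triangle_iff.1 hx
  obtain ⟨e1, e2⟩ := bary_combination hv h (vertex v (faceVertices k 0))
    (vertex v (faceVertices k 1)) (vertex v (faceVertices k 2))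
  refine ⟨![a / 12, b / 12, c / 12], ?_, ?_, ?_, ?_⟩
  · intro m
    fin_cases m <;> simp <;> positivity
  · simp
    linarith
  · rw [e1, (bary_vertex hv _).1, (bary_vertex hv _).1, (bary_vertex hv _).1]
    simp
    ring
  · rw [e2, (bary_vertex hv _).2, (bary_vertex hv _).2, (bary_vertex hv _).2]
    simp
    ring

theorem vertex_mem_triangle (hv : orient (v 0) (v 1) (v 2) ≠ 0) (j : Fin 10) :
    vertex v j ∈ triangle v := by
  rw [mem_triangle_iff_bary hv, (bary_vertex hv j).1, (bary_vertex hv j).2]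
  fin_cases j <;> norm_num [bary12]

theorem convex_triangle : Convex ℝ (triangle v) := convex_convexHull ℝ _

theorem face_subset_triangle (hv : orient (v 0) (v 1) (v 2) ≠ 0) (k : Fin 12) :
    face v k ⊆ triangle v := by
  rw [face, triangle, (convex_triangle (v := v)).convexHull_subset_iff, Set.range_subset_iff]
  exact fun m => vertex_mem_triangle hv _

/-- The value at `x` of the affine function that vanishes on the `i`-th line of the split. -/
noncomputable def lineValue (v : Fin 3 → Plane) (i : Fin 6) (x : Plane) : ℝ :=
  eval (affine (splitLine i).1) (env v x)

theorem splitLine_sign : ∀ (i : Fin 6) (k : Fin 12) (m : Fin 3),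
    if (splitLine i).2.testBit k then 0 ≤ value12 (splitLine i).1 (faceVertices k m)
    else value12 (splitLine i).1 (faceVertices k m) ≤ 0 := by
  decide +kernel

/-- No line of the split passes through the interior of a face, so each truncation is either void or
total on a whole face; the signs at its vertices decide. -/
theorem max_lineValue (hv : orient (v 0) (v 1) (v 2) ≠ 0) {k : Fin 12} {x : Plane}
    (hx : x ∈ face v k) (i : Fin 6) :
    max (lineValue v i x) 0 = if (splitLine i).2.testBit k then lineValue v i x else 0 := by
  obtain ⟨s, hs, h1, e1, e2⟩ := bary_of_mem_face hv hx
  have key : lineValue v i x = s 0 * value12 (splitLine i).1 (faceVertices k 0) +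
      s 1 * value12 (splitLine i).1 (faceVertices k 1) +
      s 2 * value12 (splitLine i).1 (faceVertices k 2) := by
    rw [lineValue, env, eval_affine, e1, e2]
    simp only [value12]
    push_cast
    linear_combination (-(splitLine i).1.1 : ℝ) * h1
  have h := splitLine_sign i k
  split_ifs at h ⊢ with hk
  · refine max_eq_left ?_
    have h' : ∀ m, (0 : ℝ) ≤ value12 (splitLine i).1 (faceVertices k m) := fun m => by
      exact_mod_cast h m
    rw [key]
    exact add_nonneg (add_nonneg (mul_nonneg (hs 0) (h' 0)) (mul_nonneg (hs 1) (h' 1)))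
      (mul_nonneg (hs 2) (h' 2))
  · refine max_eq_right ?_
    have h' : ∀ m, (value12 (splitLine i).1 (faceVertices k m) : ℝ) ≤ 0 := fun m => by
      exact_mod_cast h m
    rw [key]
    exact add_nonpos (add_nonpos (mul_nonpos_of_nonneg_of_nonpos (hs 0) (h' 0))
      (mul_nonpos_of_nonneg_of_nonpos (hs 1) (h' 1)))
      (mul_nonpos_of_nonneg_of_nonpos (hs 2) (h' 2))

/-- The function `p + ∑ qᵢ max (ℓᵢ, 0) ^ 4`. -/
noncomputable def truncatedValue (v : Fin 3 → Plane) (t : List P2) (x : Plane) : ℝ :=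
  eval (t.getD 0 []) (env v x) +
    ∑ i : Fin 6, eval (t.getD (i + 1) []) (env v x) * max (lineValue v i x) 0 ^ 4

theorem eval_pow4 {α : Type} [Coeff α] (p : α) (e : List ℝ) : eval (pow4 p) e = eval p e ^ 4 := by
  simp only [pow4, eval_mul]
  ring

theorem eval_foldr_ite {α ι : Type} [Coeff α] (p : ι → Bool) (f : ι → α) (r : α) (e : List ℝ)
    (l : List ι) :
    eval (l.foldr (fun i r => if p i then add (f i) r else r) r) e =
      eval r e + (l.map fun i => if p i then eval (f i) e else 0).sum := by
  induction l with
  | nil => simp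
  | cons a l ih =>
    rw [List.foldr_cons, List.map_cons, List.sum_cons]
    split_ifs with h
    · rw [eval_add, ih]
      ring
    · rw [ih]
      ring

/-- The right-hand side does not mention the face. Hence the pieces agree where faces meet, and the
choice of scheme is irrelevant. -/
theorem eval_piece_of_mem_face (hv : orient (v 0) (v 1) (v 2) ≠ 0) {c : ℕ} (hc : c ∈ allKnots)
    {k : Fin 12} {x : Plane} (hx : x ∈ face v k) :
    eval ((pieces 5 c).getD k zero) (env v x) = truncatedValue v (truncated (pieces 5 c)) x := by
  have h := List.all_eq_true.1 (checkTruncated_of_mem hc) k (List.mem_range.2 k.isLt)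
  have h' := eval_eq_of_eqv h (env v x)
  refine h'.trans ?_
  rw [truncatedPiece, eval_foldr_ite (fun i => (splitLine i).2.testBit k), truncatedValue,
    Fin.sum_univ_def]
  congr 3
  funext i
  rw [max_lineValue hv hx, eval_mul, eval_pow4, ← lineValue]
  split_ifs <;> simp

/-! ### Smoothness of truncated powers -/

theorem contDiff_bary₁ : ContDiff ℝ 3 (bary₁ v) := by
  unfold bary₁ orient
  fun_prop

theorem contDiff_bary₂ : ContDiff ℝ 3 (bary₂ v) := by
  unfold bary₂ orient
  fun_prop

theorem contDiff_eval (p : P2) : ContDiff ℝ 3 fun x => eval p (env v x) := by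
  have h1 : ∀ l : List ℤ, ContDiff ℝ 3 fun x => eval l [bary₂ v x] := by
    intro l
    induction l with
    | nil => exact contDiff_const
    | cons a l ih => exact contDiff_const.add (contDiff_bary₂.mul ih)
  induction p with
  | nil => exact contDiff_const
  | cons a p ih => exact (h1 a).add (contDiff_bary₁.mul ih)

theorem hasDerivAt_max_pow (n : ℕ) (x : ℝ) :
    HasDerivAt (fun y : ℝ => max y 0 ^ (n + 2)) ((n + 2) * max x 0 ^ (n + 1)) x := by
  rcases lt_trichotomy x 0 with hx | rfl | hx
  · have : (fun y : ℝ => max y 0 ^ (n + 2)) =ᶠ[nhds x] fun _ => 0 := by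
      filter_upwards [Iio_mem_nhds hx] with y hy
      rw [max_eq_right (le_of_lt hy)]
      simp
    rw [max_eq_right hx.le]
    simpa using (hasDerivAt_const x (0 : ℝ)).congr_of_eventuallyEq this
  · have : HasDerivAt (fun y : ℝ => max y 0 ^ (n + 2)) 0 0 := by
      rw [hasDerivAt_iff_isLittleO_nhds_zero]
      -- Near the origin the truncated power is at most `y ^ 2`, which is `o(y)`.
      have h : (fun h : ℝ => max (0 + h) 0 ^ (n + 2) - max 0 0 ^ (n + 2) - h • (0 : ℝ)) =O[nhds 0]
          fun h : ℝ => h ^ 2 := by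
        refine Asymptotics.IsBigO.of_bound 1 ?_
        filter_upwards [Metric.ball_mem_nhds (0 : ℝ) one_pos] with y hy
        have hy1 : |y| ≤ 1 := by simpa using (le_of_lt (mem_ball_zero_iff.1 hy))
        have h0 : 0 ≤ max y 0 := le_max_right _ _
        have h1 : max y 0 ≤ |y| := max_le (le_abs_self y) (abs_nonneg y)
        simp only [zero_add, max_self, smul_zero, sub_zero, ne_eq, Nat.add_eq_zero_iff,
          OfNat.ofNat_ne_zero, and_false, not_false_eq_true, zero_pow, Real.norm_eq_abs, one_mul]
        rw [abs_of_nonneg (pow_nonneg h0 _), abs_pow, pow_add]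
        calc max y 0 ^ n * max y 0 ^ 2 ≤ 1 * |y| ^ 2 := by
              gcongr
              exact pow_le_one₀ h0 (h1.trans hy1)
          _ = |y| ^ 2 := one_mul _
      exact h.trans_isLittleO (Asymptotics.isLittleO_pow_id one_lt_two)
    simpa using this
  · have : (fun y : ℝ => max y 0 ^ (n + 2)) =ᶠ[nhds x] fun y => y ^ (n + 2) := by
      filter_upwards [Ioi_mem_nhds hx] with y hy
      rw [max_eq_left (le_of_lt hy)]
    rw [max_eq_left hx.le]
    simpa using (hasDerivAt_pow (n + 2) x).congr_of_eventuallyEq this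

/-- Differentiation lowers the exponent by one, down to the positive part, which is merely
continuous. The exponent 4 of the truncated powers thus gives exactly the three derivatives needed.
-/
theorem contDiff_max_pow (n : ℕ) : ContDiff ℝ n fun y : ℝ => max y 0 ^ (n + 1) := by
  induction n with
  | zero =>
    rw [Nat.cast_zero, contDiff_zero]
    fun_prop
  | succ n ih =>
    have hd := hasDerivAt_max_pow n
    rw [Nat.cast_succ, contDiff_succ_iff_deriv]
    refine ⟨fun x => (hd x).differentiableAt, by simp, ?_⟩
    have : deriv (fun y : ℝ => max y 0 ^ (n + 1 + 1)) = fun x : ℝ => ((n : ℝ) + 2) * max x 0 ^ (n + 1) :=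
      funext fun x => (hd x).deriv
    rw [this]
    exact contDiff_const.mul ih

theorem contDiff_truncatedValue (t : List P2) : ContDiff ℝ 3 (truncatedValue v t) := by
  refine (contDiff_eval _).add (ContDiff.sum fun i _ => (contDiff_eval _).mul ?_)
  exact (contDiff_max_pow 3).comp (contDiff_eval _)

/-! ### Nonnegativity of the pieces -/

theorem eval_linear (a b c : ℤ) (x y z : ℝ) :
    eval (linear a b c) [x, y, z] = x * a + y * b + z * c := by
  simp only [linear, eval_cons, eval_nil, eval_int, List.tail_cons, List.headD_cons]
  push_cast
  ring

theorem eval_power (p : P3) (n : ℕ) (x y z : ℝ) :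
    eval (power p n) [x, y, z] = eval p [x, y, z] ^ n := by
  induction n with
  | zero => simp [power, eval_cons, eval_nil, eval_int]
  | succ n ih => rw [power, eval_mul, ih, pow_succ']

theorem eval_replicate_append (d : ℕ) (a : ℤ) (e : List ℝ) :
    eval (List.replicate d 0 ++ [a]) e = a * e.headD 0 ^ d := by
  induction d with
  | zero => simp [eval_cons, eval_nil, eval_int]
  | succ d ih =>
    rw [List.replicate_succ, List.cons_append, eval_cons, ih, eval_int]
    push_cast
    ring

/-- Linearity does not require the lists to fit the degree: it persists where the subtraction `d -
1` has been truncated at zero. -/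
theorem homogRow_add (d : ℕ) (p q : List ℤ) (e : List ℝ) :
    eval (homogRow d (add p q)) e = eval (homogRow d p) e + eval (homogRow d q) e := by
  have key : ∀ (p q : List ℤ) (d : ℕ), eval (homogRow d (addList add p q)) e =
      eval (homogRow d p) e + eval (homogRow d q) e := by
    intro p
    induction p with
    | nil => intro q d; simp [addList, homogRow, eval_nil]
    | cons a p ih =>
      intro q d
      cases q with
      | nil => simp [addList, homogRow, eval_nil]
      | cons b q =>
        simp only [addList, homogRow, eval_cons, eval_replicate_append, ih]
        have : ((add a b : ℤ) : ℝ) = a + b := Int.cast_add a b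
        rw [this]
        ring
  exact key p q d

theorem homog_add (d : ℕ) (p q : P2) (e : List ℝ) :
    eval (homog d (add p q)) e = eval (homog d p) e + eval (homog d q) e := by
  have key : ∀ (p q : P2) (d : ℕ), eval (homog d (addList add p q)) e =
      eval (homog d p) e + eval (homog d q) e := by
    intro p
    induction p with
    | nil => intro q d; simp [addList, homog, eval_nil]
    | cons a p ih =>
      intro q d
      cases q with
      | nil => simp [addList, homog, eval_nil]
      | cons b q =>
        simp only [addList, homog, eval_cons, homogRow_add, ih]
        ring
  exact key p q d

theorem homogRow_map (z : ℤ) (d : ℕ) (p : List ℤ) (e : List ℝ) :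
    eval (homogRow d (p.map (scale z))) e = z * eval (homogRow d p) e := by
  induction p generalizing d with
  | nil => simp [homogRow, eval_nil]
  | cons a p ih =>
    simp only [List.map_cons, homogRow, eval_cons, eval_replicate_append, ih]
    have : ((scale z a : ℤ) : ℝ) = z * a := Int.cast_mul z a
    rw [this]
    ring

theorem homogRow_scale (z : ℤ) (d : ℕ) (p : List ℤ) (e : List ℝ) :
    eval (homogRow d (scale z p)) e = z * eval (homogRow d p) e := by
  change eval (homogRow d (scaleList scale z p)) e = _
  unfold scaleList
  split
  · simp [homogRow, eval_nil]
  · exact homogRow_map _ _ _ _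

theorem homog_scale (z : ℤ) (d : ℕ) (p : P2) (e : List ℝ) :
    eval (homog d (scale z p)) e = z * eval (homog d p) e := by
  change eval (homog d (scaleList scale z p)) e = _
  unfold scaleList
  split
  · simp [homog, eval_nil]
  · induction p generalizing d with
    | nil => simp [homog, eval_nil]
    | cons a p ih =>
      simp only [List.map_cons, homog, eval_cons, homogRow_scale, ih]
      ring

theorem homog_nonneg (d : ℕ) (p : P2) (e : List ℝ) (he : ∀ x ∈ e, 0 ≤ x)
    (hp : nonneg p = true) : 0 ≤ eval (homog d p) e := by
  have hhead : ∀ e : List ℝ, (∀ x ∈ e, 0 ≤ x) → 0 ≤ e.headD 0 := by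
    intro e he
    cases e with
    | nil => simp
    | cons a l => exact he a (by simp)
  have htail : ∀ x ∈ e.tail, 0 ≤ x := fun x hx => he x (List.mem_of_mem_tail hx)
  have htail' : ∀ x ∈ e.tail.tail, 0 ≤ x := fun x hx => htail x (List.mem_of_mem_tail hx)
  have hrow : ∀ (r : List ℤ) (d : ℕ), nonneg r = true → 0 ≤ eval (homogRow d r) e.tail := by
    intro r
    induction r with
    | nil => intro d _; exact le_rfl
    | cons a r ih =>
      intro d hr
      obtain ⟨ha, hr⟩ := Bool.and_eq_true_iff.1 hr
      simp only [homogRow, eval_cons, eval_replicate_append]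
      exact add_nonneg (mul_nonneg (eval_nonneg a [] (by simp) ha)
        (pow_nonneg (hhead _ htail') _)) (mul_nonneg (hhead _ htail) (ih _ hr))
  induction p generalizing d with
  | nil => exact le_rfl
  | cons a p ih =>
    obtain ⟨ha, hp⟩ := Bool.and_eq_true_iff.1 hp
    exact add_nonneg (hrow a d ha) (mul_nonneg (hhead _ he) (ih _ hp))

theorem eval_combineRow (e : List ℝ) (d : ℕ) (y : ℝ) (l : List ℤ) (Ms : List P2) (a : ℝ)
    (hlen : l.length ≤ Ms.length)
    (h : ∀ j < l.length, eval (homog d (Ms.getD j [])) e = a * y ^ j) :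
    eval (homog d (combineRow Ms l)) e = a * eval l [y] := by
  induction l generalizing Ms a with
  | nil => cases Ms <;> simp [combineRow, homog, eval_nil]
  | cons z l ih =>
    cases Ms with
    | nil => simp at hlen
    | cons M Ms =>
      -- Passing to the tail of the table shifts the exponents by one; the factor `y` is absorbed
      -- into `a`.
      rw [combineRow, homog_add, homog_scale, ih Ms (a * y) (by simpa using hlen)]
      · have h0 := h 0 (by simp)
        simp only [List.getD_cons_zero, pow_zero, mul_one] at h0
        simp only [h0, eval_cons, eval_int, List.headD_cons]
        ring
      · intro j hj
        have := h (j + 1) (by simpa using hj)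
        rw [List.getD_cons_succ] at this
        rw [this]
        ring

theorem eval_combine (e : List ℝ) (d : ℕ) (x y : ℝ) (p : P2) (Ms : List (List P2)) (a : ℝ)
    (hlen : p.length ≤ Ms.length)
    (h : ∀ i < p.length, eval (homog d (combineRow (Ms.getD i []) (p.getD i []))) e =
      a * x ^ i * eval (p.getD i []) [y]) :
    eval (homog d (combine Ms p)) e = a * eval p [x, y] := by
  induction p generalizing Ms a with
  | nil => cases Ms <;> simp [combine, homog, eval_nil]
  | cons r p ih =>
    cases Ms with
    | nil => simp at hlen
    | cons M Ms =>
      rw [combine, homog_add, ih Ms (a * x) (by simpa using hlen)]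
      · have h0 := h 0 (by simp)
        simp only [List.getD_cons_zero, pow_zero, mul_one] at h0
        rw [h0, eval_cons, List.tail_cons, List.headD_cons]
        ring
      · intro i hi
        have := h (i + 1) (by simpa using hi)
        simp only [List.getD_cons_succ] at this
        rw [this]
        ring

/-- In the coordinates of the face the piece is a form with nonnegative coefficients, evaluated at
nonnegative arguments. -/
theorem eval_piece_nonneg (hv : orient (v 0) (v 1) (v 2) ≠ 0) {c : ℕ} (hc : c ∈ allKnots)
    {k : Fin 12} {x : Plane} (hx : x ∈ face v k) :
    0 ≤ eval ((pieces 5 c).getD k zero) (env v x) := by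
  obtain ⟨s, hs, h1, e1, e2⟩ := bary_of_mem_face hv hx
  have hcheck := List.all_eq_true.1 (checkNonneg_of_mem hc) k (List.mem_finRange k)
  obtain ⟨hdeg, hnn⟩ := Bool.and_eq_true_iff.1 hcheck
  obtain ⟨hlen, hrows⟩ := Bool.and_eq_true_iff.1 hdeg
  have hlen' : ((pieces 5 c).getD k []).length ≤ 6 := Nat.le_of_ble_eq_true hlen
  have hrows' : ∀ i < 6, (((pieces 5 c).getD k []).getD i []).length ≤ 6 - i := fun i hi =>
    Nat.le_of_ble_eq_true (List.all_eq_true.1 hrows i (List.mem_range.2 hi))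
  have htable : ∀ i < 6, ∀ j < 6 - i,
      eval (homog 5 (((monomialTable k).getD i []).getD j [])) [s 0, s 1, s 2] =
        1 * bary₁ v x ^ i * bary₂ v x ^ j := by
    intro i hi j hj
    have := List.all_eq_true.1 (List.all_eq_true.1 (checkTable_eq_true k) i
      (List.mem_range.2 hi)) j (List.mem_range.2 hj)
    rw [eval_eq_of_eqv this, monomialForm, eval_mul, eval_mul, eval_power, eval_power, eval_power,
      coeffX, coeffX, eval_linear, eval_linear, eval_linear, e1, e2]
    -- The form used to raise monomials to degree five takes the value one on the face.
    have h12 : s 0 * (12 : ℤ) + s 1 * (12 : ℤ) + s 2 * (12 : ℤ) = 1 := by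
      push_cast
      linarith
    rw [h12]
    ring
  have h := eval_combine [s 0, s 1, s 2] 5 (bary₁ v x) (bary₂ v x) ((pieces 5 c).getD k [])
    (monomialTable k) 1 (by simpa [monomialTable] using hlen') (by
      intro i hi
      refine eval_combineRow _ _ _ _ _ _ ?_ ?_
      · have hi6 : i < 6 := hi.trans_le hlen'
        simpa [monomialTable, List.getD_eq_getElem?_getD, hi6] using hrows' i hi6
      · intro j hj
        exact htable i (hi.trans_le hlen') j (hj.trans_le (hrows' i (hi.trans_le hlen'))))
  rw [one_mul] at h
  change 0 ≤ eval ((pieces 5 c).getD k []) [bary₁ v x, bary₂ v x]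
  rw [← h]
  refine homog_nonneg _ _ _ ?_ hnn
  simp only [List.mem_cons, List.not_mem_nil, or_false]
  rintro y (rfl | rfl | rfl)
  exacts [hs 0, hs 1, hs 2]

end

end PS12

namespace PS12

open Coeff

/-! ### The elements of the bases -/

def Code.element (b : Code) : BasisElement :=
  ⟨b.weight / 4, kn (mult b.knots 0) (mult b.knots 1) (mult b.knots 2) (mult b.knots 3)
    (mult b.knots 4) (mult b.knots 5), b.dual⟩

theorem basis_eq (n : Fin 6) : basis n = ((codes n).map Code.element).toFinset := by
  revert n
  decide +kernel

/-- Distinctness allows the sum over the finset `basis n` to be read as a sum over a list. -/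
theorem nodup_codes (n : Fin 6) : ((codes n).map Code.element).Nodup := by
  revert n
  decide +kernel

theorem codes_spec : ∀ n : Fin 6, ∀ b ∈ codes n, b.knots ∈ allKnots ∧ b.dual.length = 5 ∧
    0 ≤ b.weight ∧ b.element.knots.card = 8 := by
  decide +kernel

theorem sum_basis (n : Fin 6) (F : BasisElement → ℝ) :
    ∑ b ∈ basis n, F b = ((codes n).map fun b => F b.element).sum := by
  rw [basis_eq, List.sum_toFinset _ (nodup_codes n), List.map_map]
  rfl

theorem encodes_element (b : Code) : Encodes b.knots b.element.knots := by
  intro j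
  simp only [Code.element, kn, Multiset.count_add, Multiset.count_replicate]
  fin_cases j <;> simp

/-! ### Polynomial functions -/

/-- The restrictions to the plane of the polynomials of total degree at most `d`. -/
def IsPolynomial (d : ℕ) (f : Plane → ℝ) : Prop :=
  ∃ p : MvPolynomial (Fin 2) ℝ, p.totalDegree ≤ d ∧ ∀ x : Plane, f x = MvPolynomial.eval (fun i => x i) p

theorem IsPolynomial.add {d : ℕ} {f g : Plane → ℝ} (hf : IsPolynomial d f)
    (hg : IsPolynomial d g) : IsPolynomial d fun x => f x + g x := by
  obtain ⟨p, hp, hp'⟩ := hf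
  obtain ⟨q, hq, hq'⟩ := hg
  exact ⟨p + q, (MvPolynomial.totalDegree_add _ _).trans (max_le hp hq), fun x => by
    simp only [hp', hq', map_add]⟩

theorem IsPolynomial.mul {d e : ℕ} {f g : Plane → ℝ} (hf : IsPolynomial d f)
    (hg : IsPolynomial e g) : IsPolynomial (d + e) fun x => f x * g x := by
  obtain ⟨p, hp, hp'⟩ := hf
  obtain ⟨q, hq, hq'⟩ := hg
  exact ⟨p * q, (MvPolynomial.totalDegree_mul _ _).trans (add_le_add hp hq), fun x => by
    simp only [hp', hq', map_mul]⟩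

theorem isPolynomial_const (c : ℝ) : IsPolynomial 0 fun _ => c :=
  ⟨MvPolynomial.C c, by simp, fun x => by simp⟩

theorem IsPolynomial.mono {d e : ℕ} (h : d ≤ e) {f : Plane → ℝ} (hf : IsPolynomial d f) :
    IsPolynomial e f := by
  obtain ⟨p, hp, hp'⟩ := hf
  exact ⟨p, hp.trans h, hp'⟩

theorem isPolynomial_coord (i : Fin 2) : IsPolynomial 1 fun x => x i :=
  ⟨MvPolynomial.X i, by simp, fun x => by simp⟩

theorem IsPolynomial.const_mul {d : ℕ} (c : ℝ) {f : Plane → ℝ} (hf : IsPolynomial d f) :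
    IsPolynomial d fun x => c * f x := by
  simpa using (isPolynomial_const c).mul hf

theorem IsPolynomial.pow {d : ℕ} {f : Plane → ℝ} (hf : IsPolynomial d f) (n : ℕ) :
    IsPolynomial (n * d) fun x => f x ^ n := by
  induction n with
  | zero => simpa using isPolynomial_const 1
  | succ n ih => simpa [pow_succ, Nat.succ_mul] using ih.mul hf

theorem IsPolynomial.sum {ι : Type*} {d : ℕ} (s : Finset ι) {f : ι → Plane → ℝ}
    (hf : ∀ i ∈ s, IsPolynomial d (f i)) : IsPolynomial d fun x => ∑ i ∈ s, f i x := by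
  classical
  induction s using Finset.induction_on with
  | empty => simpa using (isPolynomial_const 0).mono (Nat.zero_le d)
  | insert a s ha ih =>
    simp only [Finset.sum_insert ha]
    exact (hf a (by simp)).add (ih fun i hi => hf i (by simp [hi]))

theorem isPolynomial_affine (a b c : ℝ) : IsPolynomial 1 fun x => a + b * x 0 + c * x 1 :=
  (((isPolynomial_const a).mono (Nat.zero_le 1)).add ((isPolynomial_coord 0).const_mul b)).add
    ((isPolynomial_coord 1).const_mul c)

theorem isPolynomial_bary₁ (v : Fin 3 → Plane) : IsPolynomial 1 (bary₁ v) := by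
  have := isPolynomial_affine ((v 2 0 * v 0 1 - v 2 1 * v 0 0) / orient (v 0) (v 1) (v 2))
    ((v 2 1 - v 0 1) / orient (v 0) (v 1) (v 2)) ((v 0 0 - v 2 0) / orient (v 0) (v 1) (v 2))
  convert this using 2 with x
  simp only [bary₁, orient]
  ring

theorem isPolynomial_bary₂ (v : Fin 3 → Plane) : IsPolynomial 1 (bary₂ v) := by
  have := isPolynomial_affine ((v 0 0 * v 1 1 - v 0 1 * v 1 0) / orient (v 0) (v 1) (v 2))
    ((v 0 1 - v 1 1) / orient (v 0) (v 1) (v 2)) ((v 1 0 - v 0 0) / orient (v 0) (v 1) (v 2))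
  convert this using 2 with x
  simp only [bary₂, orient]
  ring

theorem isPolynomial_eval_affine (v : Fin 3 → Plane) (f : ℤ × ℤ × ℤ) :
    IsPolynomial 1 fun x => eval (affine f) (env v x) := by
  simp only [env, eval_affine]
  exact (((isPolynomial_const _).mono (Nat.zero_le 1)).add
    ((isPolynomial_bary₁ v).const_mul _)).add ((isPolynomial_bary₂ v).const_mul _)

theorem isPolynomial_pieces (v : Fin 3 → Plane) (d c k : ℕ) :
    IsPolynomial d fun x => eval ((pieces d c).getD k zero) (env v x) := by
  induction d generalizing c with
  | zero =>
    cases h : firstTri c with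
    | none => rw [pieces_of_none _ h]; exact isPolynomial_const 0
    | some t =>
      rw [pieces_zero h, List.getD_eq_getElem?_getD, List.getElem?_map]
      cases (List.range 12)[k]? with
      | none => exact isPolynomial_const 0
      | some m =>
        simp only [Option.map_some, Option.getD_some]
        split_ifs
        · simpa [eval_cons, eval_nil, eval_int] using isPolynomial_const t.ratio
        · exact isPolynomial_const 0
  | succ d ih =>
    cases h : firstTri c with
    | none =>
      rw [pieces_of_none _ h]
      exact (isPolynomial_const 0).mono (Nat.zero_le _)
    | some t =>
      have hmul : ∀ (f : ℤ × ℤ × ℤ) (c : ℕ), IsPolynomial (d + 1) fun x =>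
          eval (((pieces d c).map (mul (affine f))).getD k zero) (env v x) := by
        intro f c
        have := (isPolynomial_eval_affine v f).mul (ih c)
        rw [add_comm] at this
        convert this using 2 with x
        exact eval_getD_map _ _ _ (fun a => eval_mul _ a _) _ _
      simp only [pieces_succ d h, eval_getD_addList]
      exact (hmul _ _).add ((hmul _ _).add (hmul _ _))

/-! ### The dual functionals -/

theorem coeffFunctional_add (P : Multiset Plane) (f g : Plane → ℝ) :
    coeffFunctional P (f + g) = coeffFunctional P f + coeffFunctional P g := by
  simp only [coeffFunctional, Pi.add_apply, Multiset.sum_map_add, mul_add, Finset.sum_add_distrib]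

theorem coeffFunctional_smul (P : Multiset Plane) (c : ℝ) (f : Plane → ℝ) :
    coeffFunctional P (c • f) = c * coeffFunctional P f := by
  simp only [coeffFunctional, Pi.smul_apply, smul_eq_mul, Multiset.sum_map_mul_left,
    Finset.mul_sum]
  exact Finset.sum_congr rfl fun k _ => by ring

theorem affine_average {l : Plane → ℝ} {a b c : ℝ} (hl : ∀ y : Plane, l y = a + b * y 0 + c * y 1)
    {k : ℕ} (hk : k ≠ 0) {R : Multiset Plane} (hR : R.card = k) :
    l ((k : ℝ)⁻¹ • R.sum) = (k : ℝ)⁻¹ * (R.map l).sum := by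
  have key : ∀ R : Multiset Plane, (R.map l).sum = R.card * a + b * R.sum 0 + c * R.sum 1 := by
    intro R
    induction R using Multiset.induction_on with
    | empty => simp
    | cons p R ih =>
      rw [Multiset.map_cons, Multiset.sum_cons, ih, hl, Multiset.card_cons, Multiset.sum_cons]
      simp only [PiLp.add_apply]
      push_cast
      ring
  have hk' : (k : ℝ) ≠ 0 := by exact_mod_cast hk
  rw [key, hl, hR]
  simp only [PiLp.smul_apply, smul_eq_mul]
  field_simp

/-- The weight `k ^ 5` cancels the averaging, leaving the alternating sum of fifth powers of partial
sums. By inclusion and exclusion only the product of all five numbers survives, with coefficient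
`5!`. -/
theorem polarization (l : List ℝ) (hl : l.length = 5) :
    ∑ k ∈ Finset.Icc (1 : ℕ) 5, ((k : ℝ) ^ 5 / (Nat.factorial 5 : ℝ)) * (-1) ^ (k - 1) *
      (((l : Multiset ℝ).powersetCard k).map fun R => ((k : ℝ)⁻¹ * R.sum) ^ 5).sum = l.prod := by
  match l, hl with
  | [a, b, c, d, e], _ =>
    have hf : (Nat.factorial 5 : ℝ) = 120 := by norm_num [Nat.factorial]
    rw [hf, show Finset.Icc (1 : ℕ) 5 = {1, 2, 3, 4, 5} by decide]
    have he : (([a, b, c, d, e] : List ℝ) : Multiset ℝ) = a ::ₘ b ::ₘ c ::ₘ d ::ₘ e ::ₘ 0 := rfl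
    rw [he]
    simp [Multiset.powersetCard_cons, Multiset.powersetCard_one]
    ring

theorem coeffFunctional_affine_pow {l : Plane → ℝ} {a b c : ℝ}
    (hl : ∀ y : Plane, l y = a + b * y 0 + c * y 1) (L : List Plane) (hL : L.length = 5) :
    coeffFunctional (L : Multiset Plane) (fun y => l y ^ 5) = (L.map l).prod := by
  rw [← polarization (L.map l) (by simpa using hL), coeffFunctional]
  refine Finset.sum_congr rfl fun k hk => ?_
  rw [← Multiset.map_coe, Multiset.powersetCard_map, Multiset.map_map]
  congr 2
  refine Multiset.map_congr rfl fun R hR => ?_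
  rw [Function.comp, affine_average hl (by simp at hk; omega) (Multiset.mem_powersetCard.1 hR).2]

theorem average_mem {s : Set Plane} (hs : Convex ℝ s) {R : Multiset Plane} (h0 : R.card ≠ 0)
    (hR : ∀ p ∈ R, p ∈ s) : (R.card : ℝ)⁻¹ • R.sum ∈ s := by
  induction R using Multiset.induction_on with
  | empty => simp at h0
  | cons p R ih =>
    rw [Multiset.card_cons, Multiset.sum_cons]
    by_cases h : R.card = 0
    · rw [Multiset.card_eq_zero] at h
      subst h
      simpa using hR p (by simp)
    · have h1 := ih h fun q hq => hR q (by simp [hq])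
      have h2 := hR p (by simp)
      have hpos : (0 : ℝ) < R.card := by exact_mod_cast Nat.pos_of_ne_zero h
      have := hs h2 h1 (a := ((R.card : ℝ) + 1)⁻¹) (b := R.card / ((R.card : ℝ) + 1))
        (by positivity) (by positivity) (by field_simp; ring)
      convert this using 1
      rw [smul_smul, smul_add]
      push_cast
      congr 2
      field_simp

/-- Every average lies in the convex set, so the bound is the sum of the absolute weights: `∑ k ^ 5
(5 choose k) / 5! = (5 + 320 + 2430 + 5120 + 3125) / 120 = 275 / 3`. -/
theorem abs_coeffFunctional_le {s : Set Plane} (hs : Convex ℝ s) {P : Multiset Plane}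
    (hcard : P.card = 5) (hP : ∀ p ∈ P, p ∈ s) {f : Plane → ℝ} {M : ℝ}
    (hf : ∀ y ∈ s, |f y| ≤ M) : |coeffFunctional P f| ≤ 275 / 3 * M := by
  have hsum : ∀ (m : Multiset (Multiset Plane)) (g : Multiset Plane → ℝ), (∀ R ∈ m, |g R| ≤ M) →
      |(m.map g).sum| ≤ m.card * M := by
    intro m g
    induction m using Multiset.induction_on with
    | empty => simp
    | cons a m ih =>
      intro h
      rw [Multiset.map_cons, Multiset.sum_cons, Multiset.card_cons]
      push_cast
      have h1 := h a (by simp)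
      have h2 := ih fun R hR => h R (by simp [hR])
      calc |g a + (m.map g).sum| ≤ |g a| + |(m.map g).sum| := abs_add_le _ _
        _ ≤ (m.card + 1) * M := by linarith
  have hterm : ∀ k ∈ Finset.Icc (1 : ℕ) 5, |((k : ℝ) ^ 5 / (Nat.factorial 5 : ℝ)) *
      (-1) ^ (k - 1) * ((P.powersetCard k).map fun R => f ((k : ℝ)⁻¹ • R.sum)).sum| ≤
      (k : ℝ) ^ 5 / 120 * ((Nat.choose 5 k : ℝ) * M) := by
    intro k hk
    have hk0 : k ≠ 0 := by simp at hk; omega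
    rw [abs_mul, abs_mul, abs_pow, abs_neg, abs_one, one_pow, mul_one]
    have h120 : (Nat.factorial 5 : ℝ) = 120 := by norm_num [Nat.factorial]
    rw [h120, abs_of_nonneg (by positivity)]
    refine mul_le_mul_of_nonneg_left ?_ (by positivity)
    have := hsum (P.powersetCard k) (fun R => f ((k : ℝ)⁻¹ • R.sum)) (by
      intro R hR
      obtain ⟨hle, hc⟩ := Multiset.mem_powersetCard.1 hR
      refine hf _ ?_
      rw [← hc]
      exact average_mem hs (by omega) fun p hp => hP p (Multiset.mem_of_le hle hp))
    rwa [Multiset.card_powersetCard, hcard] at this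
  refine (Finset.abs_sum_le_sum_abs _ _).trans ((Finset.sum_le_sum hterm).trans_eq ?_)
  rw [show Finset.Icc (1 : ℕ) 5 = {1, 2, 3, 4, 5} by decide]
  simp [Nat.choose]
  ring

end PS12

namespace PS12

open Coeff

/-! ### The Marsden identity -/

/-- Used once for each of the variables `c₀, c₁, c₂` in `eval_outer`, to pass from integer
coefficients to coefficients that are multiples of `t`. -/
theorem eval_map_of_forall {α β : Type} [Coeff α] [Coeff β] (f : α → β) (r c : ℝ)
    (e e' : List ℝ) (hf : ∀ a, eval (f a) e = eval a e' * r) (p : List α) :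
    eval (p.map f) (c :: e) = eval p (c :: e') * r := by
  induction p with
  | nil => simp [eval_nil]
  | cons a p ih =>
    simp only [List.map_cons, eval_cons, List.tail_cons, List.headD_cons, hf, ih]
    ring

theorem eval_outer {α : Type} [Coeff α] (p : P3) (t : α) (c₀ c₁ c₂ : ℝ) (e : List ℝ) :
    eval (outer p t) (c₀ :: c₁ :: c₂ :: e) = eval p [c₀, c₁, c₂] * eval t e :=
  eval_map_of_forall _ _ _ _ _ (eval_map_of_forall _ _ _ _ _
    (eval_map_of_forall _ _ _ _ _ fun z => eval_scale z t e)) p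

/-- The affine function with the values `c₀, c₁, c₂` at the corners. -/
noncomputable def interpolate (v : Fin 3 → Plane) (c₀ c₁ c₂ : ℝ) (x : Plane) : ℝ :=
  c₀ * (1 - bary₁ v x - bary₂ v x) + c₁ * bary₁ v x + c₂ * bary₂ v x

section

variable {v : Fin 3 → Plane}

theorem eval_dualPoly (hv : orient (v 0) (v 1) (v 2) ≠ 0) (c₀ c₁ c₂ : ℝ) (D : List (Fin 10)) :
    eval (dualPoly D) [c₀, c₁, c₂] =
      12 ^ D.length * (D.map fun j => interpolate v c₀ c₁ c₂ (vertex v j)).prod := by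
  induction D with
  | nil => simp [dualPoly, eval_cons, eval_nil, eval_int]
  | cons j D ih =>
    have hj : eval (linear (bary12 j).1 (bary12 j).2.1 (bary12 j).2.2) [c₀, c₁, c₂] =
        12 * interpolate v c₀ c₁ c₂ (vertex v j) := by
      have h0 : ((bary12 j).1 : ℝ) = 12 - (bary12 j).2.1 - (bary12 j).2.2 := by
        fin_cases j <;> norm_num [bary12]
      rw [eval_linear, interpolate, (bary_vertex hv j).1, (bary_vertex hv j).2, h0]
      ring
    rw [dualPoly, eval_mul, ih, hj, List.map_cons, List.prod_cons, List.length_cons]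
    ring

theorem eval_pairing (c₀ c₁ c₂ : ℝ) (x : Plane) :
    eval pairing (c₀ :: c₁ :: c₂ :: env v x) = interpolate v c₀ c₁ c₂ x := by
  simp only [pairing, env, eval_cons, eval_nil, eval_int, List.tail_cons, List.headD_cons,
    interpolate]
  push_cast
  ring

theorem eval_marsdenSum (i : ℕ) (l : List Code) (c₀ c₁ c₂ : ℝ) (e : List ℝ) :
    eval (marsdenSum i l) (c₀ :: c₁ :: c₂ :: e) =
      (l.map fun b => b.weight * eval (dualPoly b.dual) [c₀, c₁, c₂] *
        eval ((truncated (pieces 5 b.knots)).getD i []) e).sum := by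
  induction l with
  | nil => rfl
  | cons b l ih =>
    change eval (add _ (marsdenSum i l)) _ = _
    rw [eval_add, ih, eval_outer, eval_scale, List.map_cons, List.sum_cons]

/-- The scaled simplex spline with the given code, as a truncated power sum. -/
noncomputable def Code.spline (v : Fin 3 → Plane) (b : Code) (x : Plane) : ℝ :=
  b.weight / 4 * truncatedValue v (truncated (pieces 5 b.knots)) x

/-- By linearity the sum splits into a polynomial part and one coefficient for each truncated power.
The checks identify the former with the fifth power and annihilate the latter. Truncated power sums
live on the whole plane, so `x` is not confined to the triangle. -/
theorem marsden (hv : orient (v 0) (v 1) (v 2) ≠ 0) (n : Fin 6) (c₀ c₁ c₂ : ℝ) (x : Plane) :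
    ((codes n).map fun b => (b.dual.map fun j => interpolate v c₀ c₁ c₂ (vertex v j)).prod *
      b.spline v x).sum = interpolate v c₀ c₁ c₂ x ^ 5 := by
  obtain ⟨h0, hi⟩ := Bool.and_eq_true_iff.1 (checkMarsden_eq_true n)
  have h0' := eval_eq_of_eqv h0 (c₀ :: c₁ :: c₂ :: env v x)
  rw [eval_marsdenSum, eval_scale, eval_mul, eval_pow4, eval_pairing] at h0'
  have hi' : ∀ i : Fin 6, eval (marsdenSum (i + 1) (codes n)) (c₀ :: c₁ :: c₂ :: env v x) = 0 :=
    fun i => eval_of_isZero _ _ (List.all_eq_true.1 hi i (List.mem_range.2 i.isLt))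
  simp only [eval_marsdenSum] at hi'
  have hsplit : ((codes n).map fun b =>
      (b.dual.map fun j => interpolate v c₀ c₁ c₂ (vertex v j)).prod * b.spline v x).sum =
      (4 * 12 ^ 5 : ℝ)⁻¹ * (((codes n).map fun b => b.weight * eval (dualPoly b.dual) [c₀, c₁, c₂] *
        eval ((truncated (pieces 5 b.knots)).getD 0 []) (env v x)).sum +
      ∑ i : Fin 6, ((codes n).map fun b => b.weight * eval (dualPoly b.dual) [c₀, c₁, c₂] *
        eval ((truncated (pieces 5 b.knots)).getD (i + 1) []) (env v x)).sum *
          max (lineValue v i x) 0 ^ 4) := by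
    have hlen : ∀ b ∈ codes n, b.dual.length = 5 := fun b hb => (codes_spec n b hb).2.1
    generalize codes n = l at hlen
    induction l with
    | nil => simp
    | cons b l ih =>
      simp only [List.map_cons, List.sum_cons]
      rw [ih fun b hb => hlen b (by simp [hb]), eval_dualPoly hv, hlen b (by simp), Code.spline,
        truncatedValue]
      simp only [add_mul, Finset.sum_add_distrib, mul_add, Finset.mul_sum]
      have : ∀ i : Fin 6, (4 * 12 ^ 5 : ℝ)⁻¹ * ((b.weight : ℝ) * (12 ^ 5 *
          (b.dual.map fun j => interpolate v c₀ c₁ c₂ (vertex v j)).prod) *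
          eval ((truncated (pieces 5 b.knots)).getD (i + 1) []) (env v x) *
          max (lineValue v i x) 0 ^ 4) =
          (b.dual.map fun j => interpolate v c₀ c₁ c₂ (vertex v j)).prod * (b.weight / 4 *
          (eval ((truncated (pieces 5 b.knots)).getD (i + 1) []) (env v x) *
          max (lineValue v i x) 0 ^ 4)) := fun i => by ring
      simp only [this]
      ring
  rw [hsplit, h0']
  simp only [hi', zero_mul, Finset.sum_const_zero, add_zero]
  push_cast
  ring

/-! ### The quasi-interpolant -/

variable {ρ : Plane → Fin 12}

theorem scaled_simplexSpline (hv : orient (v 0) (v 1) (v 2) ≠ 0) (hρ : IsFaceScheme v ρ)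
    {n : Fin 6} {b : Code} (hb : b ∈ codes n) {x : Plane} (hx : x ∈ triangle v) :
    (b.element.weight : ℝ) * simplexSpline v ρ b.element.knots x = b.spline v x := by
  obtain ⟨hk, -, -, hcard⟩ := codes_spec n b hb
  rw [simplexSpline, hcard, simplexSplineAux_eq hv hρ hx 5 (encodes_element b) hcard,
    eval_piece_of_mem_face hv hk (hρ x hx), Code.spline]
  simp [Code.element]

theorem Code.spline_nonneg (hv : orient (v 0) (v 1) (v 2) ≠ 0) (hρ : IsFaceScheme v ρ)
    {n : Fin 6} {b : Code} (hb : b ∈ codes n) {x : Plane} (hx : x ∈ triangle v) :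
    0 ≤ b.spline v x := by
  obtain ⟨hk, -, hw, -⟩ := codes_spec n b hb
  rw [Code.spline, ← eval_piece_of_mem_face hv hk (hρ x hx)]
  exact mul_nonneg (div_nonneg (by exact_mod_cast hw) (by norm_num))
    (eval_piece_nonneg hv hk (hρ x hx))

/-- The dual points of a basis element. -/
noncomputable def Code.points (v : Fin 3 → Plane) (b : Code) : List Plane :=
  b.dual.map (vertex v)

theorem quasiInterpolant_eq (hv : orient (v 0) (v 1) (v 2) ≠ 0) (hρ : IsFaceScheme v ρ)
    (n : Fin 6) (f : Plane → ℝ) {x : Plane} (hx : x ∈ triangle v) :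
    quasiInterpolant v ρ n f x =
      ((codes n).map fun b => coeffFunctional (b.points v) f * b.spline v x).sum := by
  rw [quasiInterpolant, sum_basis]
  congr 1
  refine List.map_congr_left fun b hb => ?_
  rw [scaled_simplexSpline hv hρ hb hx]
  rfl

/-- The quasi-interpolant at `x`, as a linear functional. -/
noncomputable def quasiInterpolantAt (v : Fin 3 → Plane) (n : Fin 6) (x : Plane) :
    (Plane → ℝ) →ₗ[ℝ] ℝ where
  toFun f := ((codes n).map fun b => coeffFunctional (b.points v) f * b.spline v x).sum
  map_add' f g := by
    simp only [coeffFunctional_add, add_mul, List.sum_map_add]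
  map_smul' c f := by
    simp only [coeffFunctional_smul, mul_assoc, List.sum_map_mul_left, smul_eq_mul,
      RingHom.id_apply]

theorem isAffine_interpolate (hv : orient (v 0) (v 1) (v 2) ≠ 0) (a b c : ℝ) (y : Plane) :
    interpolate v (a + b * v 0 0 + c * v 0 1) (a + b * v 1 0 + c * v 1 1)
      (a + b * v 2 0 + c * v 2 1) y = a + b * y 0 + c * y 1 := by
  rw [interpolate, coord_eq hv y 0, coord_eq hv y 1]
  ring

/-- Polarization turns each coefficient into the product of the values of the affine function at the
dual points, which is the coefficient in the Marsden identity. -/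
theorem quasiInterpolantAt_affine_pow (hv : orient (v 0) (v 1) (v 2) ≠ 0) (n : Fin 6)
    (x : Plane) (a b c : ℝ) :
    quasiInterpolantAt v n x (fun y => (a + b * y 0 + c * y 1) ^ 5) =
      (a + b * x 0 + c * x 1) ^ 5 := by
  have h := marsden hv n (a + b * v 0 0 + c * v 0 1) (a + b * v 1 0 + c * v 1 1)
    (a + b * v 2 0 + c * v 2 1) x
  rw [isAffine_interpolate hv] at h
  rw [← h]
  change List.sum _ = _
  congr 1
  refine List.map_congr_left fun b' hb => ?_
  rw [coeffFunctional_affine_pow (l := fun y => a + b * y 0 + c * y 1) (fun _ => rfl) _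
    (by simpa [Code.points] using (codes_spec n b' hb).2.1)]
  simp only [isAffine_interpolate hv, Code.points, List.map_map]
  rfl

end

/-! ### Reproduction of quintics, stability and membership in the spline space -/

theorem coeff_eq_zero_of_forall_sum_pow {N : ℕ} {A : ℕ → ℝ}
    (h : ∀ t : ℝ, ∑ i ∈ Finset.range N, A i * t ^ i = 0) {i : ℕ} (hi : i < N) : A i = 0 := by
  have hp : (∑ i ∈ Finset.range N, Polynomial.monomial i (A i)) = 0 :=
    Polynomial.funext fun t => by
      simpa [Polynomial.eval_finsetSum, Polynomial.eval_monomial] using h t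
  have := congrArg (fun p => Polynomial.coeff p i) hp
  simpa [Polynomial.finsetSum_coeff, Polynomial.coeff_monomial, hi] using this

/-- The terms with `i + j > 5` carry a vanishing binomial coefficient, so a square range of indices
can be used. -/
theorem affine_pow_five (b c x y : ℝ) : (1 + b * x + c * y) ^ 5 =
    ∑ i ∈ Finset.range 6, ∑ j ∈ Finset.range 6,
      ((Nat.choose 5 i * Nat.choose (5 - i) j : ℕ) : ℝ) * b ^ i * c ^ j * (x ^ i * y ^ j) := by
  simp [Finset.sum_range_succ, Nat.choose]
  ring

/-- A linear functional vanishing on the fifth powers of affine functions vanishes on all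
polynomials of degree at most five. -/
theorem map_eq_zero_of_affine_pow {L : (Plane → ℝ) →ₗ[ℝ] ℝ}
    (h : ∀ b c : ℝ, L (fun y => (1 + b * y 0 + c * y 1) ^ 5) = 0) {f : Plane → ℝ}
    (hf : IsPolynomial 5 f) : L f = 0 := by
  -- The value of `L` at the fifth power is a polynomial in `b` and `c` that vanishes identically.
  -- Its coefficients are the values of `L` at the monomials times nonzero multinomial coefficients.
  have hsum : ∀ b c : ℝ, ∑ i ∈ Finset.range 6, (∑ j ∈ Finset.range 6,
      (((Nat.choose 5 i * Nat.choose (5 - i) j : ℕ) : ℝ) *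
        L (fun y => y 0 ^ i * y 1 ^ j)) * c ^ j) * b ^ i = 0 := by
    intro b c
    rw [← h b c]
    have : (fun y : Plane => (1 + b * y 0 + c * y 1) ^ 5) =
        ∑ i ∈ Finset.range 6, ∑ j ∈ Finset.range 6,
          (((Nat.choose 5 i * Nat.choose (5 - i) j : ℕ) : ℝ) * b ^ i * c ^ j) •
            fun y : Plane => y 0 ^ i * y 1 ^ j := by
      funext y
      rw [affine_pow_five]
      simp only [Finset.sum_apply, Pi.smul_apply, smul_eq_mul]
    rw [this]
    simp only [map_sum, map_smul, smul_eq_mul, Finset.sum_mul]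
    exact Finset.sum_congr rfl fun i _ => Finset.sum_congr rfl fun j _ => by ring
  have hmono : ∀ i j : ℕ, i + j ≤ 5 → L (fun y => y 0 ^ i * y 1 ^ j) = 0 := by
    intro i j hij
    have h1 : ∀ c : ℝ, _ := fun c =>
      coeff_eq_zero_of_forall_sum_pow (fun b => hsum b c) (show i < 6 by omega)
    have h2 := coeff_eq_zero_of_forall_sum_pow h1 (show j < 6 by omega)
    have h3 : ((Nat.choose 5 i * Nat.choose (5 - i) j : ℕ) : ℝ) ≠ 0 := by
      exact_mod_cast (Nat.mul_pos (Nat.choose_pos (by omega)) (Nat.choose_pos (by omega))).ne'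
    exact (mul_eq_zero.1 h2).resolve_left h3
  obtain ⟨p, hp, hp'⟩ := hf
  have : f = ∑ d ∈ p.support, p.coeff d • fun y : Plane => y 0 ^ d 0 * y 1 ^ d 1 := by
    funext y
    rw [hp', MvPolynomial.eval_eq']
    simp only [Fin.prod_univ_two, Finset.sum_apply, Pi.smul_apply, smul_eq_mul]
  rw [this, map_sum]
  refine Finset.sum_eq_zero fun d hd => ?_
  rw [map_smul, hmono, smul_zero]
  have := MvPolynomial.le_totalDegree hd
  rw [Finsupp.sum_fintype _ _ (fun _ => rfl), Fin.sum_univ_two] at this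
  exact this.trans hp

section

variable {v : Fin 3 → Plane} {ρ : Plane → Fin 12}

theorem quasiInterpolantAt_polynomial (hv : orient (v 0) (v 1) (v 2) ≠ 0) (n : Fin 6) (x : Plane)
    {f : Plane → ℝ} (hf : IsPolynomial 5 f) : quasiInterpolantAt v n x f = f x := by
  have := map_eq_zero_of_affine_pow (L := quasiInterpolantAt v n x - LinearMap.proj x) (by
    intro b c
    rw [LinearMap.sub_apply, quasiInterpolantAt_affine_pow hv]
    simp) hf
  rwa [LinearMap.sub_apply, sub_eq_zero] at this

theorem sum_spline (hv : orient (v 0) (v 1) (v 2) ≠ 0) (n : Fin 6) (x : Plane) :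
    ((codes n).map fun b => b.spline v x).sum = 1 := by
  have h := marsden hv n 1 1 1 x
  have h1 : ∀ y, interpolate v 1 1 1 y = 1 := fun y => by rw [interpolate]; ring
  simpa [h1] using h

/-- The splines are nonnegative and sum to one, so the bound for a single functional carries over to
the operator without loss. -/
theorem abs_quasiInterpolantAt_le (hv : orient (v 0) (v 1) (v 2) ≠ 0) (hρ : IsFaceScheme v ρ)
    (n : Fin 6) {x : Plane} (hx : x ∈ triangle v) {f : Plane → ℝ} {M : ℝ}
    (hf : ∀ y ∈ triangle v, |f y| ≤ M) : |quasiInterpolantAt v n x f| ≤ 275 / 3 * M := by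
  have key : ∀ l : List Code, (∀ b ∈ l, b ∈ codes n) →
      |(l.map fun b => coeffFunctional (b.points v) f * b.spline v x).sum| ≤
        275 / 3 * M * (l.map fun b => b.spline v x).sum := by
    intro l
    induction l with
    | nil => simp
    | cons b l ih =>
      intro hl
      have hb := hl b (by simp)
      rw [List.map_cons, List.map_cons, List.sum_cons, List.sum_cons, mul_add]
      refine (abs_add_le _ _).trans (add_le_add ?_ (ih fun a ha => hl a (by simp [ha])))
      have h0 := b.spline_nonneg hv hρ hb hx
      rw [abs_mul, abs_of_nonneg h0]
      refine mul_le_mul_of_nonneg_right (abs_coeffFunctional_le convex_triangle ?_ ?_ hf) h0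
      · simpa [Code.points] using (codes_spec n b hb).2.1
      · intro p hp
        simp only [Code.points, Multiset.mem_coe, List.mem_map] at hp
        obtain ⟨j, -, rfl⟩ := hp
        exact vertex_mem_triangle hv j
  have := key (codes n) fun _ h => h
  rwa [sum_spline hv, mul_one] at this

/-- Smoothness is read off the truncated powers, which are C³ on the whole plane; the degree is read
off the pieces produced by the recursion. -/
theorem quasiInterpolant_mem_splineSpace (hv : orient (v 0) (v 1) (v 2) ≠ 0)
    (hρ : IsFaceScheme v ρ) (n : Fin 6) (f : Plane → ℝ) :
    quasiInterpolant v ρ n f ∈ splineSpace v 3 5 := by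
  constructor
  · have hsmooth : ∀ l : List Code, ContDiff ℝ 3 fun x =>
        (l.map fun b => coeffFunctional (b.points v) f * b.spline v x).sum := by
      intro l
      induction l with
      | nil => exact contDiff_const
      | cons b l ih =>
        exact (contDiff_const.mul (contDiff_const.mul (contDiff_truncatedValue _))).add ih
    exact (hsmooth (codes n)).contDiffOn.congr fun x hx => quasiInterpolant_eq hv hρ n f hx
  · intro k
    have hpoly : ∀ l : List Code, (∀ b ∈ l, b ∈ codes n) → ∃ g, IsPolynomial 5 g ∧
        ∀ x ∈ face v k, (l.map fun b => coeffFunctional (b.points v) f * b.spline v x).sum =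
          g x := by
      intro l
      induction l with
      | nil => exact fun _ => ⟨_, (isPolynomial_const 0).mono (by norm_num), fun x _ => rfl⟩
      | cons b l ih =>
        intro hl
        obtain ⟨g, hg, hg'⟩ := ih fun a ha => hl a (by simp [ha])
        refine ⟨_, (((isPolynomial_pieces v 5 b.knots k).const_mul (b.weight / 4)).const_mul
          (coeffFunctional (b.points v) f)).add hg, fun x hx => ?_⟩
        rw [List.map_cons, List.sum_cons, hg' x hx, Code.spline,
          ← eval_piece_of_mem_face hv (codes_spec n b (hl b (by simp))).1 hx]
    obtain ⟨g, ⟨p, hp, hp'⟩, hg⟩ := hpoly (codes n) fun _ h => h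
    refine ⟨p, hp, fun x hx => ?_⟩
    rw [quasiInterpolant_eq hv hρ n f (face_subset_triangle hv k hx), hg x hx, hp']

theorem abs_le_supNorm {f : Plane → ℝ} (hf : ContinuousOn f (triangle v)) {y : Plane}
    (hy : y ∈ triangle v) : |f y| ≤ supNorm (triangle v) f :=
  le_csSup ((isCompact_triangle v).image_of_continuousOn hf.abs).bddAbove ⟨y, hy, rfl⟩

theorem supNorm_le {f : Plane → ℝ} {M : ℝ} (hM : 0 ≤ M) (h : ∀ x ∈ triangle v, |f x| ≤ M) :
    supNorm (triangle v) f ≤ M :=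
  Real.sSup_le (by rintro _ ⟨x, hx, rfl⟩; exact h x hx) hM

theorem supNorm_nonneg (f : Plane → ℝ) : 0 ≤ supNorm (triangle v) f :=
  Real.sSup_nonneg (by rintro _ ⟨x, -, rfl⟩; exact abs_nonneg _)

end

end PS12

namespace PS12

/-! ### Taylor polynomials of smooth functions -/

/-- The space of smooth functions on the plane. -/
def smoothFunctions : Submodule ℝ (Plane → ℝ) where
  carrier := {f | ContDiff ℝ ∞ f}
  add_mem' {f g} hf hg := ContDiff.add (show ContDiff ℝ ∞ f from hf) (show ContDiff ℝ ∞ g from hg)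
  zero_mem' := show ContDiff ℝ ∞ (fun _ : Plane => (0 : ℝ)) from contDiff_const
  smul_mem' _ f hf := ContDiff.smul contDiff_const (show ContDiff ℝ ∞ f from hf)

theorem contDiff_coe (f : smoothFunctions) : ContDiff ℝ ∞ (f : Plane → ℝ) := f.2

theorem contDiff_partialDeriv {f : Plane → ℝ} (hf : ContDiff ℝ ∞ f) (i : Fin 2) :
    ContDiff ℝ ∞ (partialDeriv i f) :=
  (hf.fderiv_right (m := ∞) (by simp)).clm_apply contDiff_const

theorem contDiff_partialDeriv_iterate {f : Plane → ℝ} (hf : ContDiff ℝ ∞ f) (i : Fin 2) (n : ℕ) :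
    ContDiff ℝ ∞ ((partialDeriv i)^[n] f) := by
  induction n with
  | zero => exact hf
  | succ n ih =>
    rw [Function.iterate_succ_apply']
    exact contDiff_partialDeriv ih i

theorem differentiableAt_of_smooth {f : Plane → ℝ} (hf : ContDiff ℝ ∞ f) (x : Plane) :
    DifferentiableAt ℝ f x :=
  (hf.differentiable (by simp)).differentiableAt

/-- The partial derivative as an operator on smooth functions. -/
noncomputable def partialEnd (i : Fin 2) : Module.End ℝ smoothFunctions where
  toFun f := ⟨partialDeriv i f, contDiff_partialDeriv f.2 i⟩
  map_add' f g := by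
    ext x
    simp [partialDeriv, fderiv_add (differentiableAt_of_smooth f.2 x)
      (differentiableAt_of_smooth g.2 x)]
  map_smul' c f := by
    ext x
    simp [partialDeriv, fderiv_const_smul (differentiableAt_of_smooth f.2 x) c]

/-- Symmetry of the second derivative. It allows the binomial theorem to be applied to directional
derivatives as elements of the endomorphism ring. -/
theorem commute_partialEnd : Commute (partialEnd 0) (partialEnd 1) := by
  refine LinearMap.ext fun f => Subtype.ext (funext fun x => ?_)
  have hsymm : IsSymmSndFDerivAt ℝ (f : Plane → ℝ) x :=
    (contDiff_infty.1 (contDiff_coe f) 2).contDiffAt.isSymmSndFDerivAt (by simp)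
  have key : ∀ i j : Fin 2, partialDeriv i (partialDeriv j f) x =
      fderiv ℝ (fderiv ℝ (f : Plane → ℝ)) x (EuclideanSpace.single i 1)
        (EuclideanSpace.single j 1) := by
    intro i j
    have hd : DifferentiableAt ℝ (fderiv ℝ (f : Plane → ℝ)) x :=
      (((contDiff_coe f).fderiv_right (m := ∞) (by simp)).differentiable (by simp)).differentiableAt
    unfold partialDeriv
    rw [fderiv_clm_apply hd (differentiableAt_const _)]
    simp
  change partialDeriv 0 (partialDeriv 1 f) x = partialDeriv 1 (partialDeriv 0 f) x
  rw [key, key]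
  exact hsymm _ _

theorem coe_partialEnd_pow (i : Fin 2) (n : ℕ) (f : smoothFunctions) :
    ((partialEnd i ^ n) f : Plane → ℝ) = (partialDeriv i)^[n] f := by
  induction n with
  | zero => rfl
  | succ n ih =>
    rw [pow_succ', Function.iterate_succ_apply', ← ih]
    rfl

/-- The mixed partial derivative `∂₀ ^ i ∂₁ ^ j f`. -/
noncomputable def mixedDeriv (i j : ℕ) (f : Plane → ℝ) : Plane → ℝ :=
  (partialDeriv 0)^[i] ((partialDeriv 1)^[j] f)

theorem fderiv_apply_eq {f : Plane → ℝ} (x w : Plane) :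
    fderiv ℝ f x w = w 0 * partialDeriv 0 f x + w 1 * partialDeriv 1 f x := by
  have hw : w = w 0 • EuclideanSpace.single 0 1 + w 1 • EuclideanSpace.single 1 1 := by
    apply plane_ext <;> simp
  conv_lhs => rw [hw]
  simp [partialDeriv]

theorem iteratedDeriv_line (f : smoothFunctions) (z w : Plane) (n : ℕ) :
    iteratedDeriv n (fun s : ℝ => (f : Plane → ℝ) (z + s • w)) = fun s =>
      (((w 0 • partialEnd 0 + w 1 • partialEnd 1) ^ n) f : Plane → ℝ) (z + s • w) := by
  induction n with
  | zero => simp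
  | succ n ih =>
    rw [iteratedDeriv_succ, ih]
    funext s
    set g := ((w 0 • partialEnd 0 + w 1 • partialEnd 1) ^ n) f
    have h1 : HasDerivAt (fun s : ℝ => z + s • w) w s := by
      simpa using ((hasDerivAt_id s).smul_const w).const_add z
    have h2 := (differentiableAt_of_smooth g.2 (z + s • w)).hasFDerivAt.comp_hasDerivAt s h1
    refine h2.deriv.trans ?_
    rw [fderiv_apply_eq, pow_succ']
    rfl

/-- The binomial theorem for the commuting operators `w 0 • ∂₀` and `w 1 • ∂₁`. -/
theorem directional_pow (f : smoothFunctions) (w y : Plane) (n : ℕ) :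
    (((w 0 • partialEnd 0 + w 1 • partialEnd 1) ^ n) f : Plane → ℝ) y =
      ∑ m ∈ Finset.range (n + 1),
        w 0 ^ m * w 1 ^ (n - m) * n.choose m * mixedDeriv m (n - m) f y := by
  have hc : Commute (w 0 • partialEnd 0) (w 1 • partialEnd 1) :=
    (commute_partialEnd.smul_left _).smul_right _
  rw [hc.add_pow, LinearMap.sum_apply, Submodule.coe_sum, Finset.sum_apply]
  refine Finset.sum_congr rfl fun m _ => ?_
  have : ((w 0 • partialEnd 0) ^ m * (w 1 • partialEnd 1) ^ (n - m) *
      (n.choose m : Module.End ℝ smoothFunctions) : Module.End ℝ smoothFunctions) f = (w 0 ^ m * w 1 ^ (n - m) * n.choose m) •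
        (partialEnd 0 ^ m) ((partialEnd 1 ^ (n - m)) f) := by
    rw [smul_pow, smul_pow]
    have hn : (n.choose m : Module.End ℝ smoothFunctions) f = (n.choose m : ℝ) • f := by
      rw [Module.End.natCast_apply, Nat.cast_smul_eq_nsmul]
    rw [Module.End.mul_apply, Module.End.mul_apply, hn, map_smul, map_smul, LinearMap.smul_apply,
      LinearMap.smul_apply, map_smul, smul_smul, smul_smul]
    congr 1
    ring
  rw [this, Submodule.coe_smul, Pi.smul_apply, coe_partialEnd_pow, coe_partialEnd_pow, smul_eq_mul]
  rfl

/-- The Taylor polynomial of degree five of `f` at `z`, at the point `z + w`. -/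
noncomputable def taylorFive (f : Plane → ℝ) (z w : Plane) : ℝ :=
  ∑ k ∈ Finset.range 6, (k.factorial : ℝ)⁻¹ * ∑ m ∈ Finset.range (k + 1),
    w 0 ^ m * w 1 ^ (k - m) * k.choose m * mixedDeriv m (k - m) f z

theorem isPolynomial_taylorFive (f : Plane → ℝ) (z u : Plane) (t : ℝ) :
    IsPolynomial 5 fun y => taylorFive f z (t • (y - u)) := by
  have hc : ∀ i : Fin 2, IsPolynomial 1 fun y : Plane => (t • (y - u)) i := by
    intro i
    have := ((isPolynomial_coord i).add
      ((isPolynomial_const (-(u i))).mono (Nat.zero_le 1))).const_mul t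
    convert this using 2 with y
    simp only [PiLp.smul_apply, PiLp.sub_apply, smul_eq_mul]
    ring
  refine IsPolynomial.sum _ fun k hk => (IsPolynomial.sum _ fun m hm => ?_).const_mul _
  rw [Finset.mem_range] at hk hm
  have := ((((hc 0).pow m).mul ((hc 1).pow (k - m))).mul (isPolynomial_const
    ((k.choose m : ℝ)))).mul (isPolynomial_const (mixedDeriv m (k - m) f z))
  exact this.mono (by omega)

theorem abs_coord_le (w : Plane) (i : Fin 2) : |w i| ≤ ‖w‖ := by
  simpa using PiLp.norm_apply_le w i

/-- Taylor's theorem in one variable along the segment from `z` to `z + w`. -/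
theorem abs_sub_taylorFive_le {f : Plane → ℝ} (hf : ContDiff ℝ ∞ f) {z w : Plane} {M r : ℝ}
    (hw : ‖w‖ ≤ r) (hM : ∀ s ∈ Set.Icc (0 : ℝ) 1, ∀ m ≤ 6, |mixedDeriv m (6 - m) f (z + s • w)| ≤ M) :
    |f (z + w) - taylorFive f z w| ≤ 64 / 120 * r ^ 6 * M := by
  let F : smoothFunctions := ⟨f, hf⟩
  have hline : ContDiff ℝ ∞ fun s : ℝ => f (z + s • w) :=
    hf.comp (contDiff_const.add (contDiff_id.smul contDiff_const))
  have hiter : ∀ n, ∀ s ∈ Set.Icc (0 : ℝ) 1,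
      iteratedDerivWithin n (fun s : ℝ => f (z + s • w)) (Set.Icc 0 1) s =
        ∑ m ∈ Finset.range (n + 1),
          w 0 ^ m * w 1 ^ (n - m) * n.choose m * mixedDeriv m (n - m) f (z + s • w) := by
    intro n s hs
    rw [iteratedDerivWithin_eq_iteratedDeriv (uniqueDiffOn_Icc one_pos)
      ((contDiff_infty.1 hline _).contDiffAt) hs]
    exact (congrFun (iteratedDeriv_line F z w n) s).trans (directional_pow F w _ n)
  have hr : 0 ≤ r := (norm_nonneg w).trans hw
  have hM0 : 0 ≤ M := (abs_nonneg _).trans (hM 0 (by simp) 0 (by norm_num))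
  -- The sixth derivative along the segment is at most `∑ (6 choose m) r ^ 6 M = 64 r ^ 6 M`. The
  -- remainder estimate divides by `5!`, not `6!`, whence 120.
  have h := taylor_mean_remainder_bound (f := fun s : ℝ => f (z + s • w)) (a := 0) (b := 1)
    (C := 64 * r ^ 6 * M) (x := 1) (n := 5) zero_le_one
    (contDiff_infty.1 hline _).contDiffOn (by simp) (by
      intro s hs
      rw [hiter _ s hs]
      have hterm : ∀ m ∈ Finset.range 7, ‖w 0 ^ m * w 1 ^ (6 - m) * (Nat.choose 6 m : ℝ) *
          mixedDeriv m (6 - m) f (z + s • w)‖ ≤ Nat.choose 6 m * (r ^ 6 * M) := by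
        intro m hm
        have hm' : m ≤ 6 := by rw [Finset.mem_range] at hm; omega
        rw [norm_mul, norm_mul, norm_mul, norm_pow, norm_pow, Real.norm_natCast]
        have h0 : ‖w 0‖ ≤ r := (abs_coord_le w 0).trans hw
        have h1 : ‖w 1‖ ≤ r := (abs_coord_le w 1).trans hw
        calc ‖w 0‖ ^ m * ‖w 1‖ ^ (6 - m) * (Nat.choose 6 m : ℝ) *
              ‖mixedDeriv m (6 - m) f (z + s • w)‖
            ≤ r ^ m * r ^ (6 - m) * (Nat.choose 6 m : ℝ) * M := by
              gcongr
              exact hM s hs m hm'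
          _ = Nat.choose 6 m * (r ^ 6 * M) := by
              rw [← pow_add, Nat.add_sub_cancel' hm']
              ring
      refine (norm_sum_le _ _).trans ((Finset.sum_le_sum hterm).trans_eq ?_)
      simp [Finset.sum_range_succ, Nat.choose]
      ring)
  rw [taylor_within_apply] at h
  have hT : ∑ k ∈ Finset.range (5 + 1), ((k.factorial : ℝ)⁻¹ * (1 - 0) ^ k) •
      iteratedDerivWithin k (fun s : ℝ => f (z + s • w)) (Set.Icc 0 1) 0 = taylorFive f z w := by
    refine Finset.sum_congr rfl fun k _ => ?_
    rw [hiter k 0 (by simp)]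
    simp
  rw [hT, one_smul, Real.norm_eq_abs] at h
  refine h.trans_eq ?_
  norm_num [Nat.factorial]
  ring

end PS12

namespace PS12

/-! ### Mollification -/

open ContinuousLinearMap Convolution

theorem partialDeriv_convolution {f g : Plane → ℝ} (hf : LocallyIntegrable f volume)
    (hg : ContDiff ℝ ∞ g) (hgc : HasCompactSupport g) (i : Fin 2) :
    partialDeriv i (f ⋆[lsmul ℝ ℝ, volume] g) = f ⋆[lsmul ℝ ℝ, volume] (partialDeriv i g) := by
  funext x
  have hg1 : ContDiff ℝ 1 g := by exact_mod_cast contDiff_infty.1 hg 1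
  unfold partialDeriv
  rw [(hgc.hasFDerivAt_convolution_right (lsmul ℝ ℝ) hf hg1 x).fderiv,
    convolution_precompR_apply (lsmul ℝ ℝ) hf (hgc.fderiv ℝ) (hg1.continuous_fderiv one_ne_zero)]

theorem hasCompactSupport_partialDeriv {g : Plane → ℝ} (hgc : HasCompactSupport g) (i : Fin 2) :
    HasCompactSupport (partialDeriv i g) :=
  hgc.fderiv_apply ℝ _

theorem partialDeriv_iterate_convolution {f g : Plane → ℝ} (hf : LocallyIntegrable f volume)
    (hg : ContDiff ℝ ∞ g) (hgc : HasCompactSupport g) (i : Fin 2) (n : ℕ) :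
    HasCompactSupport ((partialDeriv i)^[n] g) ∧
    (partialDeriv i)^[n] (f ⋆[lsmul ℝ ℝ, volume] g) =
      f ⋆[lsmul ℝ ℝ, volume] ((partialDeriv i)^[n] g) := by
  induction n with
  | zero => exact ⟨hgc, rfl⟩
  | succ n ih =>
    simp only [Function.iterate_succ_apply']
    exact ⟨hasCompactSupport_partialDeriv ih.1 i, by
      rw [ih.2, partialDeriv_convolution hf (contDiff_partialDeriv_iterate hg i n) ih.1]⟩

theorem mixedDeriv_convolution {f g : Plane → ℝ} (hf : LocallyIntegrable f volume)
    (hg : ContDiff ℝ ∞ g) (hgc : HasCompactSupport g) (i j : ℕ) :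
    mixedDeriv i j (f ⋆[lsmul ℝ ℝ, volume] g) =
      f ⋆[lsmul ℝ ℝ, volume] (mixedDeriv i j g) := by
  obtain ⟨h1, h2⟩ := partialDeriv_iterate_convolution hf hg hgc 1 j
  rw [mixedDeriv, h2, (partialDeriv_iterate_convolution hf
    (contDiff_partialDeriv_iterate hg 1 j) h1 0 i).2]
  rfl

theorem partialDeriv_reflect {g : Plane → ℝ} (hg : ContDiff ℝ ∞ g) (x : Plane) (c : ℝ)
    (i : Fin 2) :
    partialDeriv i (fun y => c * g (x - y)) = fun y => -c * partialDeriv i g (x - y) := by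
  funext y
  have h1 : HasFDerivAt (fun y : Plane => x - y) (-(ContinuousLinearMap.id ℝ Plane)) y :=
    (hasFDerivAt_id y).const_sub x
  have h2 := ((differentiableAt_of_smooth hg (x - y)).hasFDerivAt.comp y h1).const_mul c
  unfold partialDeriv
  refine (congrArg (fun L : Plane →L[ℝ] ℝ => L (EuclideanSpace.single i 1)) h2.fderiv).trans ?_
  simp

theorem partialDeriv_iterate_reflect {g : Plane → ℝ} (hg : ContDiff ℝ ∞ g) (x : Plane) (c : ℝ)
    (i : Fin 2) (n : ℕ) :
    (partialDeriv i)^[n] (fun y => c * g (x - y)) =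
      fun y => (-1) ^ n * c * (partialDeriv i)^[n] g (x - y) := by
  induction n with
  | zero => simp
  | succ n ih =>
    simp only [Function.iterate_succ_apply']
    rw [ih, partialDeriv_reflect (contDiff_partialDeriv_iterate hg i n)]
    funext y
    ring

/-- Reflected mollifiers serve as test functions; this sign cancels the one in the definition of a
weak derivative. -/
theorem mixedDeriv_reflect {g : Plane → ℝ} (hg : ContDiff ℝ ∞ g) (x : Plane) (i j : ℕ) :
    mixedDeriv i j (fun y => g (x - y)) = fun y => (-1) ^ (i + j) * mixedDeriv i j g (x - y) := by
  have h1 := partialDeriv_iterate_reflect hg x 1 1 j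
  simp only [one_mul, mul_one] at h1
  rw [mixedDeriv, h1, partialDeriv_iterate_reflect (contDiff_partialDeriv_iterate hg 1 j)]
  funext y
  rw [mixedDeriv, pow_add]

/-- The derivatives of a mollification are bounded by the weak derivatives. -/
theorem abs_mixedDeriv_mollification_le {U : Set Plane} (hU : IsOpen U) {f g : Plane → ℝ}
    {i j : ℕ} (hf : IntegrableOn f U) (hg : IsWeakDeriv U (i, j) f g) {M : ℝ}
    (hM : ∀ᵐ y ∂volume.restrict U, |g y| ≤ M) (φ : ContDiffBump (0 : Plane)) {x : Plane}
    (hx : Metric.closedBall x φ.rOut ⊆ U) :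
    |mixedDeriv i j (U.indicator f ⋆[lsmul ℝ ℝ, volume] (φ.normed volume)) x| ≤ M := by
  set η : Plane → ℝ := φ.normed volume
  have hη : ContDiff ℝ ∞ η := φ.contDiff_normed
  have hηc : HasCompactSupport η := φ.hasCompactSupport_normed
  have hloc : LocallyIntegrable (U.indicator f) volume :=
    ((integrable_indicator_iff hU.measurableSet).2 hf).locallyIntegrable
  set ψ : Plane → ℝ := fun y => η (x - y)
  have hψ : ContDiff ℝ ∞ ψ := hη.comp (contDiff_const.sub contDiff_id)
  have hsub : tsupport ψ ⊆ Metric.closedBall x φ.rOut := by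
    refine closure_minimal ?_ Metric.isClosed_closedBall
    intro y hy
    have : x - y ∈ Function.support η := hy
    rw [φ.support_normed_eq, mem_ball_zero_iff] at this
    rw [Metric.mem_closedBall, dist_comm, dist_eq_norm]
    exact this.le
  have hψc : HasCompactSupport ψ :=
    (isCompact_closedBall x φ.rOut).of_isClosed_subset (isClosed_tsupport _) hsub
  have hψi : Integrable ψ volume := hψ.continuous.integrable_of_hasCompactSupport hψc
  have hψ1 : ∫ y, ψ y = 1 := by
    rw [← φ.integral_normed (μ := volume)]
    exact integral_sub_left_eq_self η volume x
  have hψ0 : ∀ y, 0 ≤ ψ y := fun y => φ.nonneg_normed _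
  -- The reflected bump is an admissible test function because its support lies in the closed ball,
  -- hence in `U`.
  have hw := hg ψ hψ hψc (hsub.trans hx)
  have hconv : mixedDeriv i j (U.indicator f ⋆[lsmul ℝ ℝ, volume] η) x =
      (-1) ^ (i + j) * ∫ y in U, f y * mixedDeriv i j ψ y := by
    rw [mixedDeriv_convolution hloc hη hηc, convolution_def, mixedDeriv_reflect hη,
      ← integral_const_mul, ← integral_indicator hU.measurableSet]
    congr 1
    funext y
    by_cases hy : y ∈ U
    · simp only [Set.indicator_of_mem hy, lsmul_apply, smul_eq_mul]
      have : ((-1 : ℝ) ^ (i + j)) * (-1) ^ (i + j) = 1 := by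
        rw [← mul_pow]
        norm_num
      linear_combination (-(f y * mixedDeriv i j η (x - y))) * this
    · simp [Set.indicator_of_notMem hy]
  have hw' : ∫ y in U, f y * mixedDeriv i j ψ y = (-1) ^ (i + j) * ∫ y in U, g y * ψ y := hw
  rw [hconv, hw', abs_mul, abs_mul, abs_pow, abs_neg, abs_one, one_pow, one_mul, one_mul]
  -- An almost everywhere bound forces `0 ≤ M` only because the open set `U` is nonempty and so has
  -- positive measure.
  have hM0 : 0 ≤ M := by
    have hne : (volume.restrict U) ≠ 0 := by
      have hxU : x ∈ U := hx (Metric.mem_closedBall_self φ.rOut_pos.le)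
      rw [Ne, Measure.restrict_eq_zero]
      exact (hU.measure_pos volume ⟨x, hxU⟩).ne'
    have : (ae (volume.restrict U)).NeBot := ae_neBot.2 hne
    obtain ⟨y, hy⟩ := hM.exists
    exact (abs_nonneg _).trans hy
  calc |∫ y in U, g y * ψ y| ≤ ∫ y in U, M * ψ y := by
        rw [← Real.norm_eq_abs]
        refine norm_integral_le_of_norm_le (hψi.const_mul M).integrableOn ?_
        filter_upwards [hM] with y hy
        rw [norm_mul, Real.norm_eq_abs, Real.norm_eq_abs, abs_of_nonneg (hψ0 y)]
        exact mul_le_mul_of_nonneg_right hy (hψ0 y)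
    _ ≤ ∫ y, M * ψ y := setIntegral_le_integral (hψi.const_mul M)
        (Filter.Eventually.of_forall fun y => mul_nonneg hM0 (hψ0 y))
    _ = M := by rw [integral_const_mul, hψ1, mul_one]

theorem abs_mollification_sub_le {U : Set Plane} (hU : IsOpen U) {f : Plane → ℝ}
    (hf : IntegrableOn f U) (φ : ContDiffBump (0 : Plane)) {x : Plane} {ε : ℝ}
    (hx : Metric.closedBall x φ.rOut ⊆ U)
    (hε : ∀ y ∈ Metric.ball x φ.rOut, |f y - f x| ≤ ε) :
    |(U.indicator f ⋆[lsmul ℝ ℝ, volume] (φ.normed volume)) x - f x| ≤ ε := by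
  have hxU : x ∈ U := hx (Metric.mem_closedBall_self φ.rOut_pos.le)
  have hmeas : AEStronglyMeasurable (U.indicator f) volume :=
    ((integrable_indicator_iff hU.measurableSet).2 hf).aestronglyMeasurable
  have h := φ.dist_normed_convolution_le (μ := volume) (x₀ := x) (ε := ε) hmeas (by
    intro y hy
    rw [Set.indicator_of_mem hxU, Set.indicator_of_mem (hx (Metric.ball_subset_closedBall hy)),
      Real.dist_eq]
    exact hε y hy)
  rw [Set.indicator_of_mem hxU, Real.dist_eq] at h
  -- The bump is the left factor in `dist_normed_convolution_le` and the right factor here; the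
  -- convolution is symmetric.
  convert h using 3
  rw [← convolution_flip]
  congr 1
  ext
  simp

end PS12

namespace PS12

/-! ### The order of approximation -/

open ContinuousLinearMap Convolution

/-- The derivatives are essentially bounded, so the supremum is finite and `toReal` does not
collapse it to zero. -/
theorem ae_abs_le_sobolevSeminorm {U : Set Plane} {m : ℕ} {f : Plane → ℝ}
    {g : ℕ × ℕ → Plane → ℝ} (hf : IsSobolevWith U m f g) {α : ℕ × ℕ} (hα : α.1 + α.2 = m) :
    ∀ᵐ y ∂volume.restrict U, |g α y| ≤ sobolevSeminorm U m g := by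
  have hfin : (Finset.HasAntidiagonal.antidiagonal m).sup
      (fun α => eLpNorm (g α) ⊤ (volume.restrict U)) ≠ ⊤ := by
    refine ((Finset.sup_lt_iff (by simp)).2 fun β hβ => ?_).ne
    exact (hf β (Finset.HasAntidiagonal.mem_antidiagonal.1 hβ).le).1.2
  have hle : eLpNorm (g α) ⊤ (volume.restrict U) ≤ (Finset.HasAntidiagonal.antidiagonal m).sup
      (fun α => eLpNorm (g α) ⊤ (volume.restrict U)) :=
    Finset.le_sup (f := fun α => eLpNorm (g α) ⊤ (volume.restrict U))
      (Finset.HasAntidiagonal.mem_antidiagonal.2 hα)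
  rw [eLpNorm_exponent_top] at hle
  filter_upwards [ae_le_eLpNormEssSup (f := g α) (μ := volume.restrict U)] with y hy
  have := ENNReal.toReal_mono hfin (hy.trans hle)
  simpa [sobolevSeminorm] using this

theorem sobolevSeminorm_nonneg (U : Set Plane) (m : ℕ) (g : ℕ × ℕ → Plane → ℝ) :
    0 ≤ sobolevSeminorm U m g :=
  ENNReal.toReal_nonneg

variable {v : Fin 3 → Plane}

theorem interior_triangle_nonempty (hv : orient (v 0) (v 1) (v 2) ≠ 0) :
    (interior (triangle v)).Nonempty := by
  have h1 : Continuous (bary₁ v) := contDiff_bary₁.continuous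
  have h2 : Continuous (bary₂ v) := contDiff_bary₂.continuous
  have ho : IsOpen {x : Plane | 0 < 1 - bary₁ v x - bary₂ v x ∧ 0 < bary₁ v x ∧ 0 < bary₂ v x} :=
    (isOpen_lt continuous_const ((continuous_const.sub h1).sub h2)).inter
      ((isOpen_lt continuous_const h1).inter (isOpen_lt continuous_const h2))
  refine ⟨vertex v 9, interior_maximal (fun x hx => ?_) ho ?_⟩
  · exact (mem_triangle_iff_bary hv x).2 ⟨hx.1.le, hx.2.1.le, hx.2.2.le⟩
  · change 0 < 1 - bary₁ v (vertex v 9) - bary₂ v (vertex v 9) ∧ 0 < bary₁ v (vertex v 9) ∧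
      0 < bary₂ v (vertex v 9)
    rw [(bary_vertex hv 9).1, (bary_vertex hv 9).2]
    have h9 : bary12 9 = (4, 4, 4) := rfl
    rw [h9]
    norm_num

/-- Functions in the Sobolev space are approximated by quintic polynomials, up to an arbitrarily
small error that has to be measured on its own. -/
theorem exists_polynomial_near (hv : orient (v 0) (v 1) (v 2) ≠ 0) {f : Plane → ℝ}
    {g : ℕ × ℕ → Plane → ℝ} (hf : ContinuousOn f (triangle v))
    (hg : IsSobolevWith (interior (triangle v)) 6 f g) {ε : ℝ} (hε : 0 < ε) :
    ∃ P : Plane → ℝ, IsPolynomial 5 P ∧ ∀ y ∈ triangle v, |f y - P y| ≤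
      64 / 120 * Metric.diam (triangle v) ^ 6 * sobolevSeminorm (interior (triangle v)) 6 g + ε := by
  set T := triangle v
  set U := interior T
  set h := Metric.diam T
  have hT : IsCompact T := isCompact_triangle v
  have hconv : Convex ℝ T := convex_triangle
  have hU : IsOpen U := isOpen_interior
  have hUT : U ⊆ T := interior_subset
  obtain ⟨z, hz⟩ := interior_triangle_nonempty hv
  have hzT : z ∈ T := hUT hz
  have hh : 0 ≤ h := Metric.diam_nonneg
  have hdist : ∀ y ∈ T, ‖y - z‖ ≤ h := fun y hy => by
    rw [← dist_eq_norm]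
    exact Metric.dist_le_diam_of_mem hT.isBounded hy hzT
  obtain ⟨δ, hδ, hunif⟩ := Metric.uniformContinuousOn_iff.1
    (hT.uniformContinuousOn_of_continuous hf) (ε / 2) (half_pos hε)
  -- contract the triangle towards an interior point
  set θ : ℝ := min 1 (δ / (2 * (h + 1)))
  have hθ0 : 0 < θ := lt_min one_pos (by positivity)
  have hθ1 : θ ≤ 1 := min_le_left _ _
  -- The contraction moves every point of the triangle by less than `δ`, so it changes `f` by at
  -- most `ε / 2`.
  have hθh : θ * h < δ := by
    have h1 : θ ≤ δ / (2 * (h + 1)) := min_le_right _ _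
    calc θ * h ≤ δ / (2 * (h + 1)) * h := mul_le_mul_of_nonneg_right h1 hh
      _ = δ * (h / (2 * (h + 1))) := by ring
      _ < δ * 1 := by
          refine mul_lt_mul_of_pos_left ?_ hδ
          rw [div_lt_one (by positivity)]
          linarith
      _ = δ := mul_one δ
  set σ : Plane → Plane := fun y => z + (1 - θ) • (y - z)
  have hσ : ∀ y ∈ T, σ y ∈ U := by
    intro y hy
    have := hconv.add_smul_sub_mem_interior hy hz ⟨hθ0, hθ1⟩
    convert this using 1
    simp only [σ]
    module
  have hσc : Continuous σ := by fun_prop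
  -- The contracted triangle is compact in the open set `U`, which leaves room for one mollification
  -- radius valid at all its points.
  obtain ⟨r, hr, hrU⟩ := (hT.image hσc).exists_cthickening_subset_open hU
    (Set.image_subset_iff.2 hσ)
  set r' : ℝ := min r (δ / 2)
  have hr' : 0 < r' := lt_min hr (half_pos hδ)
  let φ : ContDiffBump (0 : Plane) := ⟨r' / 2, r', half_pos hr', half_lt_self hr'⟩
  have hball : ∀ y ∈ T, Metric.closedBall (σ y) φ.rOut ⊆ U := by
    intro y hy
    refine (Metric.closedBall_subset_closedBall (min_le_left _ _)).trans
      ((Metric.closedBall_subset_cthickening ?_ r).trans hrU)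
    exact ⟨y, hy, rfl⟩
  have hint : IntegrableOn f U := (hf.integrableOn_compact hT).mono_set hUT
  set G : Plane → ℝ := U.indicator f ⋆[lsmul ℝ ℝ, volume] (φ.normed volume)
  have hG : ContDiff ℝ ∞ G := φ.hasCompactSupport_normed.contDiff_convolution_right _
    ((integrable_indicator_iff hU.measurableSet).2 hint).locallyIntegrable φ.contDiff_normed
  -- The value at `y` is that of the Taylor polynomial of the mollification `G` at the contracted
  -- point `σ y`, so derivatives of `G` are needed only on the contracted triangle.
  refine ⟨fun y => taylorFive G z ((1 - θ) • (y - z)), isPolynomial_taylorFive G z z (1 - θ),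
    fun y hy => ?_⟩
  have h1 : |f y - f (σ y)| ≤ ε / 2 := by
    have hd : dist y (σ y) < δ := by
      have : y - σ y = θ • (y - z) := by simp only [σ]; module
      rw [dist_eq_norm, this, norm_smul, Real.norm_of_nonneg hθ0.le]
      exact (mul_le_mul_of_nonneg_left (hdist y hy) hθ0.le).trans_lt hθh
    exact (hunif y hy (σ y) (hUT (hσ y hy)) hd).le
  have h2 : |G (σ y) - f (σ y)| ≤ ε / 2 := by
    refine abs_mollification_sub_le hU hint φ (hball y hy) fun w hw => ?_
    have hwU := hball y hy (Metric.ball_subset_closedBall hw)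
    refine (hunif w (hUT hwU) (σ y) (hUT (hσ y hy)) ?_).le
    refine (Metric.mem_ball.1 hw).trans_le ((min_le_right _ _).trans ?_)
    linarith
  have h3 : |G (z + (1 - θ) • (y - z)) - taylorFive G z ((1 - θ) • (y - z))| ≤
      64 / 120 * h ^ 6 * sobolevSeminorm U 6 g := by
    refine abs_sub_taylorFive_le hG ?_ fun s hs m hm => ?_
    · rw [norm_smul, Real.norm_of_nonneg (by linarith)]
      calc (1 - θ) * ‖y - z‖ ≤ 1 * ‖y - z‖ :=
            mul_le_mul_of_nonneg_right (by linarith) (norm_nonneg _)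
        _ ≤ h := by simpa using hdist y hy
    · have hmem : z + s • (y - z) ∈ T := by
        have := hconv hzT hy (a := 1 - s) (b := s) (by linarith [hs.2]) hs.1 (by ring)
        convert this using 1
        module
      -- The segment from `z` to `σ y` is the image under `σ` of the segment from `z` to `y`, so the
      -- mollification ball about each of its points stays in `U`.
      have heq : z + s • (1 - θ) • (y - z) = σ (z + s • (y - z)) := by
        simp only [σ]
        module
      have hsum : m + (6 - m) = 6 := Nat.add_sub_cancel' hm
      rw [heq]
      exact abs_mixedDeriv_mollification_le hU hint (hg (m, 6 - m) hsum.le).2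
        (ae_abs_le_sobolevSeminorm hg hsum) φ (hball _ hmem)
  have hsplit : f y - taylorFive G z ((1 - θ) • (y - z)) = (f y - f (σ y)) - (G (σ y) - f (σ y)) +
      (G (z + (1 - θ) • (y - z)) - taylorFive G z ((1 - θ) • (y - z))) := by
    simp only [σ]
    ring
  rw [hsplit]
  have h4 := abs_add_le ((f y - f (σ y)) - (G (σ y) - f (σ y)))
    (G (z + (1 - θ) • (y - z)) - taylorFive G z ((1 - θ) • (y - z)))
  have h5 := abs_sub (f y - f (σ y)) (G (σ y) - f (σ y))
  linarith

/-- The Lebesgue inequality: a quintic `P` is reproduced, so the error is that of `f - P`, amplified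
by at most `1 + 275 / 3 = 278 / 3`. The tolerance `3 / 278 * ε` is chosen to cancel this factor. -/
theorem abs_quasiInterpolantAt_sub_le (hv : orient (v 0) (v 1) (v 2) ≠ 0) {ρ : Plane → Fin 12}
    (hρ : IsFaceScheme v ρ) (n : Fin 6) {f : Plane → ℝ} {g : ℕ × ℕ → Plane → ℝ}
    (hf : ContinuousOn f (triangle v)) (hg : IsSobolevWith (interior (triangle v)) 6 f g)
    {x : Plane} (hx : x ∈ triangle v) :
    |quasiInterpolantAt v n x f - f x| ≤ 278 / 3 * (64 / 120) *
      Metric.diam (triangle v) ^ 6 * sobolevSeminorm (interior (triangle v)) 6 g := by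
  refine le_of_forall_pos_le_add fun ε hε => ?_
  obtain ⟨P, hP, hPf⟩ := exists_polynomial_near hv hf hg (ε := 3 / 278 * ε) (by positivity)
  set B := 64 / 120 * Metric.diam (triangle v) ^ 6 * sobolevSeminorm (interior (triangle v)) 6 g
  have h1 := abs_quasiInterpolantAt_le hv hρ n hx (f := f - P) hPf
  have h2 : quasiInterpolantAt v n x f - f x =
      quasiInterpolantAt v n x (f - P) - (f x - P x) := by
    rw [map_sub, quasiInterpolantAt_polynomial hv n x hP]
    ring
  rw [h2]
  refine (abs_sub _ _).trans ((add_le_add h1 (hPf x hx)).trans_eq ?_)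
  simp only [B]
  ring

end PS12

/-! ### The four assertions together -/

theorem mainTheorem7 :
    (∀ (n : Fin 6) (v : Fin 3 → Plane), AffineIndependent ℝ v →
      ∀ ρ : Plane → Fin 12, IsFaceScheme v ρ →
        (∀ f : Plane → ℝ, ContinuousOn f (triangle v) →
          quasiInterpolant v ρ n f ∈ splineSpace v 3 5) ∧
        (∀ p : MvPolynomial (Fin 2) ℝ, p.totalDegree ≤ 5 → ∀ x ∈ triangle v,
          quasiInterpolant v ρ n (fun y => MvPolynomial.eval (fun i => y i) p) x =
            MvPolynomial.eval (fun i => x i) p) ∧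
        (∀ f : Plane → ℝ, ContinuousOn f (triangle v) →
          supNorm (triangle v) (quasiInterpolant v ρ n f) ≤
            275 / 3 * supNorm (triangle v) f)) ∧
    ∃ C : ℝ, ∀ (n : Fin 6) (v : Fin 3 → Plane), AffineIndependent ℝ v →
      ∀ ρ : Plane → Fin 12, IsFaceScheme v ρ →
        ∀ (f : Plane → ℝ) (g : ℕ × ℕ → Plane → ℝ), ContinuousOn f (triangle v) →
          IsSobolevWith (interior (triangle v)) 6 f g →
          supNorm (triangle v) (fun x => quasiInterpolant v ρ n f x - f x) ≤
            C * Metric.diam (triangle v) ^ 6 *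
              sobolevSeminorm (interior (triangle v)) 6 g := by
  refine ⟨fun n v hv ρ hρ => ?_, 278 / 3 * (64 / 120), fun n v hv ρ hρ f g hf hg => ?_⟩
  · have hv' := orient_ne_zero hv
    refine ⟨fun f _ => quasiInterpolant_mem_splineSpace hv' hρ n f, fun p hp x hx => ?_,
      fun f hf => ?_⟩
    · rw [quasiInterpolant_eq hv' hρ n _ hx]
      exact quasiInterpolantAt_polynomial hv' n x ⟨p, hp, fun _ => rfl⟩
    · refine supNorm_le (mul_nonneg (by norm_num) (supNorm_nonneg f)) fun x hx => ?_
      rw [quasiInterpolant_eq hv' hρ n f hx]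
      exact abs_quasiInterpolantAt_le hv' hρ n hx fun y hy => abs_le_supNorm hf hy
  · have hv' := orient_ne_zero hv
    refine supNorm_le ?_ fun x hx => ?_
    · have := sobolevSeminorm_nonneg (interior (triangle v)) 6 g
      have := Metric.diam_nonneg (s := triangle v)
      positivity
    · rw [quasiInterpolant_eq hv' hρ n f hx]
      exact abs_quasiInterpolantAt_sub_le hv' hρ n hf hg hx
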